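/- Fix $\tau\in(0,1)$ and an integer $p\ge 0$. Let $(X_i,Y_i)$, $i\ge 1$, be iid random pairs with values in $\mathbb R^{p+1}\times\mathbb R$; let $G$ be the distribution of $X_i$, and suppose that for $G$-almost every $x$ the conditional $\tau$-quantile is linear, $Q_\tau(Y\mid X=x):=\inf\{y: P(Y\le y\mid X=x)\ge\tau\}=x^\top\theta^\star$, with true value $\theta^\star\in\mathbb R^{p+1}$. Assume: (1) $E(XX^\top)$ exists (all entries are integrable) and is positive definite; (2) for $G$-almost every $x$, the conditional distribution of $Y$ given $X=x$ has a finite first absolute moment and admits a continuous Lebesgue density $f_x$ on $\mathbb R$, and there is a constant $c>0$ with $f_x(x^\top\theta^\star)\ge c$ for $G$-almost every $x$. Let $R_n(\theta)=\frac1n\sum_{i=1}^n\bigl|(Y_i-X_i^\top\theta)\,(\tau-I\{Y_i-X_i^\top\theta<0\})\bigr|$ be the empirical check-loss risk. Let $\Pi$ be any prior probability distribution on $\mathbb R^{p+1}$ which on some open neighborhood of $\theta^\star$ has a Lebesgue density that is continuous and bounded away from zero there. For a fixed scale $\omega>0$, let $\Pi_{n,\omega}$ be the Gibbs posterior, i.e.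 the (data-dependent) probability measure with $$\Pi_{n,\omega}(d\theta)\propto e^{-\omega n R_n(\theta)}\,\Pi(d\theta).$$ Then, for every real sequence $a_n\to\infty$, $$\Pi_{n,\omega}\bigl(\{\theta:\|\theta-\theta^\star\|>a_n n^{-1/2}\}\bigr)\to 0\quad\text{in probability as } n\to\infty,$$ where $\|\cdot\|$ is the Euclidean norm. -/

import Mathlib

open MeasureTheory ProbabilityTheory Filter Topology

noncomputable section

namespace QuantReg

/-- The check loss `ℓ_θ(x, y) = |(y - xᵀθ) (τ - 1{y - xᵀθ < 0})|`. -/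
def checkLoss {d : ℕ} (τ : ℝ) (θ x : EuclideanSpace ℝ (Fin d)) (y : ℝ) : ℝ :=
  |(y - inner ℝ x θ) * (τ - Set.indicator (Set.Iio (0 : ℝ)) 1 (y - inner ℝ x θ))|

/-- The empirical risk `R_n(θ) = n⁻¹ ∑_{i < n} ℓ_θ(x_i, y_i)`; the sample consists of the first
`n` terms of the sequences `x` and `y`. -/
def empiricalRisk {d : ℕ} (τ : ℝ) (n : ℕ) (x : ℕ → EuclideanSpace ℝ (Fin d)) (y : ℕ → ℝ)
    (θ : EuclideanSpace ℝ (Fin d)) : ℝ :=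
  (1 / (n : ℝ)) * ∑ i ∈ Finset.range n, checkLoss τ θ (x i) (y i)

/-- The Gibbs posterior `Π_{n,ω}(dθ) ∝ exp (-ω n R_n(θ)) Π(dθ)` with prior `Π` and scale `ω`:
the prior reweighted by this density and normalized. -/
def gibbsPosterior {d : ℕ} (τ ω : ℝ) (Pri : Measure (EuclideanSpace ℝ (Fin d))) (n : ℕ)
    (x : ℕ → EuclideanSpace ℝ (Fin d)) (y : ℕ → ℝ) : Measure (EuclideanSpace ℝ (Fin d)) :=
  Pri.tilted fun θ => -(ω * n * empiricalRisk τ n x y θ)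

/-- The `τ`-th quantile `inf {y : F(y) ≥ τ}` of a probability measure with distribution
function `F`. -/
def quantile (ν : Measure ℝ) (τ : ℝ) : ℝ :=
  sInf {y : ℝ | τ ≤ cdf ν y}

/-- The matrix `E(XXᵀ)` for a random vector `X` with distribution `G`. -/
def secondMoment {d : ℕ} (G : Measure (EuclideanSpace ℝ (Fin d))) : Matrix (Fin d) (Fin d) ℝ :=
  Matrix.of fun i j => ∫ x, x i * x j ∂G

/-- On some open neighbourhood of `θ₀`, the measure `Pri` has a Lebesgue density that is
continuous and bounded away from zero there. -/
def HasContinuousPositiveDensityNear {d : ℕ} (Pri : Measure (EuclideanSpace ℝ (Fin d)))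
    (θ₀ : EuclideanSpace ℝ (Fin d)) : Prop :=
  ∃ (U : Set (EuclideanSpace ℝ (Fin d))) (dens : EuclideanSpace ℝ (Fin d) → ℝ) (c : ℝ),
    IsOpen U ∧ θ₀ ∈ U ∧ ContinuousOn dens U ∧ 0 < c ∧ (∀ θ ∈ U, c ≤ dens θ) ∧
      Pri.restrict U = (volume.restrict U).withDensity fun θ => ENNReal.ofReal (dens θ)

end QuantReg

end

noncomputable section

namespace QuantReg

/-! ### Deterministic concentration of tilted measures with a convex potential -/

section Tilted

/-! Let `M θ` be the sum over the sample of the excess check loss over `θ₀`, the true parameter. `M`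
is convex and vanishes at `θ₀`. So if `M ≥ B > 0` on the sphere of radius `t = K / √n`, then `M θ ≥
B ‖θ - θ₀‖ / t` outside it, and the whole problem reduces to a bound on one small sphere.

On the sphere, the excess loss of an observation is a linear term, the predictor increment times the
score, plus a nonnegative remainder bounded below by `bump` (`score_add_bump_le_checkLoss_sub`). The
score has conditional mean zero by the quantile model, so Chebyshev makes the linear part of order
`t √n = K`. The remainder has mean at least `m t²`, by Fatou and the lower bound on the density at
the quantile, so its sum has mean at least `m K²` and fluctuations of order `K`. For large `K` the
drift wins, with failure probability of order `1 / K²`. A finite net of directions with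
soft-thresholded predictors makes this uniform over the sphere (`le_sum_checkLoss_sub_of_net`), with
only second moments of the covariates.

Given the growth of `M`, `tilted_real_setOf_lt_norm_le` bounds the posterior deterministically.
Inside a fixed ball around `θ₀`, the homothety of ratio 2 compares the Gibbs integral with itself,
at a cost of `2 ^ d` and a gain exponential in `a n`. Outside that ball the numerator is
exponentially small in `√n`, while the normalizing constant is at least polynomial in `1 / n`. -/

theorem tilted_real_le_of_setLIntegral_le {α : Type*} [MeasurableSpace α] {ν : Measure α}
    [IsProbabilityMeasure ν] {g : α → ℝ} (hg : Integrable (fun a => Real.exp (g a)) ν)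
    {A : Set α} (hA : MeasurableSet A) {b : ℝ} (hb : 0 ≤ b)
    (h : ∫⁻ a in A, ENNReal.ofReal (Real.exp (g a)) ∂ν
      ≤ ENNReal.ofReal b * ∫⁻ a, ENNReal.ofReal (Real.exp (g a)) ∂ν) :
    (ν.tilted g).real A ≤ b := by
  have hZ : 0 < ∫ a, Real.exp (g a) ∂ν := integral_exp_pos hg
  have h1 : ENNReal.ofReal (∫ a, Real.exp (g a) ∂ν)
      = ∫⁻ a, ENNReal.ofReal (Real.exp (g a)) ∂ν :=
    ofReal_integral_eq_lintegral_ofReal hg (ae_of_all _ fun a => (Real.exp_pos _).le)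
  have h2 : ENNReal.ofReal (∫ a in A, Real.exp (g a) ∂ν)
      = ∫⁻ a in A, ENNReal.ofReal (Real.exp (g a)) ∂ν :=
    ofReal_integral_eq_lintegral_ofReal hg.integrableOn
      (ae_of_all _ fun a => (Real.exp_pos _).le)
  rw [← h1, ← h2, ← ENNReal.ofReal_mul hb,
    ENNReal.ofReal_le_ofReal_iff (mul_nonneg hb hZ.le)] at h
  rw [measureReal_def, tilted_apply_eq_ofReal_integral' _ hA, integral_div,
    ENNReal.toReal_ofReal (div_nonneg (integral_nonneg fun a => (Real.exp_pos _).le) hZ.le),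
    div_le_iff₀ hZ]
  exact h

theorem tilted_const_add {α : Type*} [MeasurableSpace α] (ν : Measure α)
    [IsProbabilityMeasure ν] (k : ℝ) (g : α → ℝ) :
    ν.tilted (fun a => k + g a) = ν.tilted g := by
  have h := tilted_tilted (μ := ν) (f := fun _ => k) (integrable_const _) g
  rw [tilted_const] at h
  rw [h]
  rfl

/-- A potential that grows at least linearly along rays out of `x₀` is bounded below by a linear
function outside a sphere on which it is bounded below. -/
theorem linear_growth_of_sphere {E : Type*} [NormedAddCommGroup E] [NormedSpace ℝ E]
    {x₀ : E} {M : E → ℝ} {t B : ℝ} (ht : 0 < t)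
    (hray : ∀ x, ∀ s : ℝ, 1 ≤ s → s * M x ≤ M (x₀ + s • (x - x₀)))
    (hsphere : ∀ x, ‖x - x₀‖ = t → B ≤ M x) {x : E} (hx : t ≤ ‖x - x₀‖) :
    B * ‖x - x₀‖ / t ≤ M x := by
  have hpos : 0 < ‖x - x₀‖ := ht.trans_le hx
  have h1 := hray (x₀ + (t / ‖x - x₀‖) • (x - x₀)) (‖x - x₀‖ / t) (by rwa [one_le_div ht])
  have h2 : x₀ + (‖x - x₀‖ / t) • (x₀ + (t / ‖x - x₀‖) • (x - x₀) - x₀) = x := by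
    rw [add_sub_cancel_left, smul_smul, div_mul_div_cancel₀ ht.ne', div_self hpos.ne', one_smul,
      add_sub_cancel]
  have h3 := hsphere (x₀ + (t / ‖x - x₀‖) • (x - x₀)) (by
    rw [add_sub_cancel_left, norm_smul, Real.norm_of_nonneg (by positivity),
      div_mul_cancel₀ _ hpos.ne'])
  rw [h2] at h1
  calc B * ‖x - x₀‖ / t = ‖x - x₀‖ / t * B := by ring
    _ ≤ ‖x - x₀‖ / t * M (x₀ + (t / ‖x - x₀‖) • (x - x₀)) := by gcongr
    _ ≤ M x := h1

variable {E : Type*} [NormedAddCommGroup E] [NormedSpace ℝ E] [FiniteDimensional ℝ E]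
  [MeasurableSpace E] [BorelSpace E] {vol : Measure E} [vol.IsAddHaarMeasure]

theorem lintegral_eq_two_pow_mul_lintegral_homothety (x₀ : E) {F : E → ENNReal}
    (hF : Measurable F) :
    ∫⁻ x, F x ∂vol
      = ENNReal.ofReal (2 ^ Module.finrank ℝ E) * ∫⁻ x, F (x₀ + (2 : ℝ) • (x - x₀)) ∂vol := by
  have h1 : ∫⁻ x, F (x₀ + (2 : ℝ) • (x - x₀)) ∂vol = ∫⁻ x, F (x₀ + (2 : ℝ) • x) ∂vol :=
    lintegral_sub_right_eq_self (fun x => F (x₀ + (2 : ℝ) • x)) x₀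
  have h2 : ∫⁻ x, F (x₀ + (2 : ℝ) • x) ∂vol
      = ∫⁻ x, F (x₀ + x) ∂(vol.map ((2 : ℝ) • ·)) :=
    (lintegral_map (f := fun x => F (x₀ + x)) (by fun_prop) (by fun_prop)).symm
  rw [h1, h2, Measure.map_addHaar_smul vol (two_ne_zero), lintegral_smul_measure,
    lintegral_add_left_eq_self F x₀, smul_eq_mul, ← mul_assoc, ← ENNReal.ofReal_mul (by positivity),
    abs_of_pos (by positivity), mul_inv_cancel₀ (by positivity)]
  simp

/-- Substitute `x ↦ x₀ + 2 (x - x₀)`. Since `M` at least doubles, one copy of `M x` reproduces the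
integrand on the ball and the other is at least `B r / (2 t)`. Comparing the integral with itself
avoids a separate lower bound for the normalizing constant, which would cost powers of `n`. -/
theorem setLIntegral_shell_le {x₀ : E} {M : E → ℝ} {t B ω r δ : ℝ} (ht : 0 < t) (hB : 0 < B)
    (hω : 0 < ω) (hM : Measurable M)
    (hray : ∀ x, ∀ s : ℝ, 1 ≤ s → s * M x ≤ M (x₀ + s • (x - x₀)))
    (hsphere : ∀ x, ‖x - x₀‖ = t → B ≤ M x) (hr : 2 * t ≤ r) :
    ∫⁻ x in {x | r < ‖x - x₀‖} ∩ Metric.closedBall x₀ δ,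
        ENNReal.ofReal (Real.exp (-(ω * M x))) ∂vol
      ≤ ENNReal.ofReal (2 ^ Module.finrank ℝ E * Real.exp (-(ω * B * r / (2 * t))))
        * ∫⁻ x in Metric.closedBall x₀ δ, ENNReal.ofReal (Real.exp (-(ω * M x))) ∂vol := by
  have hS : MeasurableSet ({x : E | r < ‖x - x₀‖} ∩ Metric.closedBall x₀ δ) :=
    (measurableSet_lt measurable_const (by fun_prop)).inter Metric.isClosed_closedBall.measurableSet
  have hG : Measurable fun x => ENNReal.ofReal (Real.exp (-(ω * M x))) := by fun_prop
  rw [← lintegral_indicator hS, ← lintegral_indicator Metric.isClosed_closedBall.measurableSet,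
    lintegral_eq_two_pow_mul_lintegral_homothety x₀ (hG.indicator hS),
    ENNReal.ofReal_mul (by positivity), mul_assoc,
    ← lintegral_const_mul _ (hG.indicator Metric.isClosed_closedBall.measurableSet)]
  gcongr with x
  by_cases hx : x₀ + (2 : ℝ) • (x - x₀) ∈ {x : E | r < ‖x - x₀‖} ∩ Metric.closedBall x₀ δ
  · rw [Set.indicator_of_mem hx]
    obtain ⟨h1, h2⟩ := hx
    rw [Set.mem_ofPred_eq, add_sub_cancel_left, norm_smul, Real.norm_two] at h1
    rw [mem_closedBall_iff_norm, add_sub_cancel_left, norm_smul, Real.norm_two] at h2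
    have h3 : x ∈ Metric.closedBall x₀ δ := by
      rw [mem_closedBall_iff_norm]
      linarith [norm_nonneg (x - x₀)]
    rw [Set.indicator_of_mem h3, ← ENNReal.ofReal_mul (by positivity), ← Real.exp_add]
    gcongr
    -- The halved point has distance more than `r / 2 ≥ t` from `x₀`, so linear growth already
    -- applies to it.
    have h4 := linear_growth_of_sphere ht hray hsphere (x := x) (by linarith)
    have h5 := hray x 2 one_le_two
    have h6 : B * r / (2 * t) ≤ B * ‖x - x₀‖ / t := by
      rw [div_le_div_iff₀ (by positivity) ht]
      nlinarith [mul_pos hB ht]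
    have h7 : ω * B * r / (2 * t) = ω * (B * r / (2 * t)) := by ring
    rw [h7]
    nlinarith
  · rw [Set.indicator_of_notMem hx]
    exact zero_le

/-- The set is split at the ball of radius `δ`, where `ν` is comparable to Haar measure. Inside, the
shell estimate transfers at the price `C / c`. Outside, nothing is known about `ν` beyond total mass
one, so linear growth bounds the numerator and the ball of radius `s` bounds the denominator. -/
theorem tilted_real_setOf_lt_norm_le {ν : Measure E} [IsProbabilityMeasure ν]
    {x₀ : E} {M : E → ℝ} {t B ω r δ c C H s : ℝ} (ht : 0 < t) (hB : 0 < B) (hω : 0 < ω)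
    (hM : Measurable M) (hint : Integrable (fun x => Real.exp (-(ω * M x))) ν)
    (hray : ∀ x, ∀ s : ℝ, 1 ≤ s → s * M x ≤ M (x₀ + s • (x - x₀)))
    (hsphere : ∀ x, ‖x - x₀‖ = t → B ≤ M x) (hr : 2 * t ≤ r) (htδ : t ≤ δ)
    (hH : 0 ≤ H) (hMH : ∀ x, M x ≤ H * ‖x - x₀‖) (hs : 0 < s) (hsδ : s ≤ δ)
    (hc : 0 < c) (hC : 0 < C)
    (hlow : ENNReal.ofReal c • vol.restrict (Metric.closedBall x₀ δ)
      ≤ ν.restrict (Metric.closedBall x₀ δ))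
    (hup : ν.restrict (Metric.closedBall x₀ δ)
      ≤ ENNReal.ofReal C • vol.restrict (Metric.closedBall x₀ δ)) :
    (ν.tilted fun x => -(ω * M x)).real {x | r < ‖x - x₀‖}
      ≤ C / c * 2 ^ Module.finrank ℝ E * Real.exp (-(ω * B * r / (2 * t)))
        + Real.exp (-(ω * B * δ / t)) * Real.exp (ω * (H * s))
          / (c * (s ^ Module.finrank ℝ E * vol.real (Metric.ball 0 1))) := by
  set G : E → ENNReal := fun x => ENNReal.ofReal (Real.exp (-(ω * M x))) with hGdef
  have hG : Measurable G := by fun_prop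
  have hv : 0 < vol.real (Metric.ball (0 : E) 1) :=
    ENNReal.toReal_pos (Metric.measure_ball_pos vol 0 one_pos).ne' measure_ball_lt_top.ne
  set K := Metric.closedBall x₀ δ with hK
  have hKm : MeasurableSet K := Metric.isClosed_closedBall.measurableSet
  have hA : MeasurableSet {x : E | r < ‖x - x₀‖} :=
    measurableSet_lt measurable_const (by fun_prop)
  have hZK : ENNReal.ofReal c * ∫⁻ x in K, G x ∂vol ≤ ∫⁻ x, G x ∂ν := by
    calc ENNReal.ofReal c * ∫⁻ x in K, G x ∂vol
        = ∫⁻ x, G x ∂(ENNReal.ofReal c • vol.restrict K) := by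
          rw [lintegral_smul_measure, smul_eq_mul]
      _ ≤ ∫⁻ x in K, G x ∂ν := lintegral_mono' hlow le_rfl
      _ ≤ ∫⁻ x, G x ∂ν := setLIntegral_le_lintegral _ _
  have hnear : ∫⁻ x in {x : E | r < ‖x - x₀‖} ∩ K, G x ∂ν
      ≤ ENNReal.ofReal (C / c * 2 ^ Module.finrank ℝ E * Real.exp (-(ω * B * r / (2 * t))))
        * ∫⁻ x, G x ∂ν := by
    calc ∫⁻ x in {x : E | r < ‖x - x₀‖} ∩ K, G x ∂ν
        = ∫⁻ x in {x : E | r < ‖x - x₀‖}, G x ∂(ν.restrict K) := by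
          rw [Measure.restrict_restrict hA]
      _ ≤ ∫⁻ x in {x : E | r < ‖x - x₀‖}, G x ∂(ENNReal.ofReal C • vol.restrict K) :=
          lintegral_mono' (Measure.restrict_mono le_rfl hup) le_rfl
      _ = ENNReal.ofReal C * ∫⁻ x in {x : E | r < ‖x - x₀‖} ∩ K, G x ∂vol := by
          rw [Measure.restrict_smul, lintegral_smul_measure, Measure.restrict_restrict hA,
            smul_eq_mul]
      _ ≤ ENNReal.ofReal C *
          (ENNReal.ofReal (2 ^ Module.finrank ℝ E * Real.exp (-(ω * B * r / (2 * t))))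
            * ∫⁻ x in K, G x ∂vol) := by
          gcongr
          exact setLIntegral_shell_le ht hB hω hM hray hsphere hr
      _ = ENNReal.ofReal (C / c * 2 ^ Module.finrank ℝ E * Real.exp (-(ω * B * r / (2 * t))))
          * (ENNReal.ofReal c * ∫⁻ x in K, G x ∂vol) := by
          rw [← mul_assoc, ← mul_assoc, ← ENNReal.ofReal_mul hC.le,
            ← ENNReal.ofReal_mul (by positivity)]
          congr 2
          field_simp
      _ ≤ _ := by gcongr
  have hfar : ∫⁻ x in {x : E | r < ‖x - x₀‖} \ K, G x ∂ν
      ≤ ENNReal.ofReal (Real.exp (-(ω * B * δ / t)) * Real.exp (ω * (H * s))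
          / (c * (s ^ Module.finrank ℝ E * vol.real (Metric.ball 0 1)))) * ∫⁻ x, G x ∂ν := by
    have h1 : ∫⁻ x in {x : E | r < ‖x - x₀‖} \ K, G x ∂ν
        ≤ ENNReal.ofReal (Real.exp (-(ω * B * δ / t))) := by
      calc ∫⁻ x in {x : E | r < ‖x - x₀‖} \ K, G x ∂ν
          ≤ ∫⁻ x in {x : E | r < ‖x - x₀‖} \ K,
              ENNReal.ofReal (Real.exp (-(ω * B * δ / t))) ∂ν := by
            refine setLIntegral_mono measurable_const fun x hx => ?_
            have hxδ : δ < ‖x - x₀‖ := by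
              have := hx.2
              rwa [hK, mem_closedBall_iff_norm, not_le] at this
            have h4 := linear_growth_of_sphere ht hray hsphere (x := x) (by linarith)
            have h6 : B * δ / t ≤ B * ‖x - x₀‖ / t := by gcongr
            have h7 : ω * B * δ / t = ω * (B * δ / t) := by ring
            simp only [hGdef]
            gcongr
            rw [h7]
            gcongr
            linarith
        _ ≤ ∫⁻ _, ENNReal.ofReal (Real.exp (-(ω * B * δ / t))) ∂ν :=
            setLIntegral_le_lintegral _ _
        _ = _ := by simp
    have h2 : ENNReal.ofReal (Real.exp (-(ω * (H * s)))
          * (c * (s ^ Module.finrank ℝ E * vol.real (Metric.ball 0 1)))) ≤ ∫⁻ x, G x ∂ν := by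
      calc _ = ENNReal.ofReal c * (ENNReal.ofReal (Real.exp (-(ω * (H * s))))
              * vol (Metric.closedBall x₀ s)) := by
            rw [Measure.addHaar_closedBall vol _ hs.le, measureReal_def,
              ← ENNReal.ofReal_toReal (measure_ball_lt_top (μ := vol) (x := (0 : E)) (r := 1)).ne,
              ENNReal.toReal_ofReal ENNReal.toReal_nonneg, ← ENNReal.ofReal_mul (by positivity),
              ← ENNReal.ofReal_mul (by positivity), ← ENNReal.ofReal_mul (by positivity)]
            congr 1
            ring
        _ = ENNReal.ofReal c * ∫⁻ _ in Metric.closedBall x₀ s,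
              ENNReal.ofReal (Real.exp (-(ω * (H * s)))) ∂vol := by
            rw [setLIntegral_const]
        _ ≤ ENNReal.ofReal c * ∫⁻ x in Metric.closedBall x₀ s, G x ∂vol := by
            gcongr ENNReal.ofReal c * ?_
            refine setLIntegral_mono hG fun x hx => ?_
            rw [mem_closedBall_iff_norm] at hx
            simp only [hGdef]
            gcongr
            exact (hMH x).trans (by gcongr)
        _ ≤ ENNReal.ofReal c * ∫⁻ x in K, G x ∂vol := by
            gcongr
            exact Metric.closedBall_subset_closedBall hsδ
        _ ≤ _ := hZK
    refine h1.trans (le_trans (le_of_eq ?_) (mul_le_mul_right h2 _))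
    rw [← ENNReal.ofReal_mul (by positivity)]
    congr 1
    rw [Real.exp_neg (ω * (H * s))]
    field_simp
  refine tilted_real_le_of_setLIntegral_le hint hA (by positivity) ?_
  rw [ENNReal.ofReal_add (by positivity) (by positivity), add_mul,
    ← lintegral_inter_add_sdiff _ _ hKm]
  exact add_le_add hnear hfar

end Tilted

theorem HasContinuousPositiveDensityNear.exists_closedBall {d : ℕ}
    {Pri : Measure (EuclideanSpace ℝ (Fin d))} {θ₀ : EuclideanSpace ℝ (Fin d)}
    (h : HasContinuousPositiveDensityNear Pri θ₀) :
    ∃ δ c C : ℝ, 0 < δ ∧ 0 < c ∧ 0 < C ∧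
      ENNReal.ofReal c • volume.restrict (Metric.closedBall θ₀ δ)
        ≤ Pri.restrict (Metric.closedBall θ₀ δ) ∧
      Pri.restrict (Metric.closedBall θ₀ δ)
        ≤ ENNReal.ofReal C • volume.restrict (Metric.closedBall θ₀ δ) := by
  obtain ⟨U, dens, c, hU, hθ, hcont, hc, hdens, hPri⟩ := h
  obtain ⟨δ, hδ, hball⟩ := Metric.nhds_basis_closedBall.mem_iff.1 (hU.mem_nhds hθ)
  set K := Metric.closedBall θ₀ δ with hK
  have hKm : MeasurableSet K := Metric.isClosed_closedBall.measurableSet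
  obtain ⟨C, hC⟩ := (isCompact_closedBall θ₀ δ).bddAbove_image (hcont.mono hball)
  have hCK : ∀ x ∈ K, dens x ≤ C := fun x hx => hC ⟨x, hx, rfl⟩
  have hCpos : 0 < C := hc.trans_le ((hdens θ₀ hθ).trans (hCK θ₀ (Metric.mem_closedBall_self hδ.le)))
  have hrest : Pri.restrict K
      = (volume.restrict K).withDensity fun θ => ENNReal.ofReal (dens θ) := by
    rw [← Set.inter_eq_self_of_subset_left hball, ← Measure.restrict_restrict hKm, hPri,
      restrict_withDensity hKm, Measure.restrict_restrict hKm]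
  refine ⟨δ, c, C, hδ, hc, hCpos, ?_, ?_⟩
  · rw [hrest, ← withDensity_const]
    exact withDensity_mono ((ae_restrict_iff' hKm).2 (ae_of_all _ fun x hx =>
      ENNReal.ofReal_le_ofReal (hdens x (hball hx))))
  · rw [hrest, ← withDensity_const]
    exact withDensity_mono ((ae_restrict_iff' hKm).2 (ae_of_all _ fun x hx =>
      ENNReal.ofReal_le_ofReal (hCK x hx)))

/-! ### The check loss -/

section CheckLoss

variable {d : ℕ} {τ : ℝ}

theorem checkLoss_eq_max (hτ : τ ∈ Set.Ioo (0 : ℝ) 1) (θ x : EuclideanSpace ℝ (Fin d)) (y : ℝ) :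
    checkLoss τ θ x y = max (τ * (y - inner ℝ x θ)) ((τ - 1) * (y - inner ℝ x θ)) := by
  obtain ⟨h0, h1⟩ := hτ
  unfold checkLoss
  rcases lt_or_ge (y - inner ℝ x θ) 0 with h | h
  · rw [Set.indicator_of_mem (Set.mem_Iio.2 h), Pi.one_apply, abs_of_pos (by nlinarith),
      max_eq_right (by nlinarith), mul_comm]
  · rw [Set.indicator_of_notMem (by simpa using h), sub_zero, abs_of_nonneg (by positivity),
      max_eq_left (by nlinarith), mul_comm]

theorem checkLoss_nonneg (τ : ℝ) (θ x : EuclideanSpace ℝ (Fin d)) (y : ℝ) :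
    0 ≤ checkLoss τ θ x y :=
  abs_nonneg _

theorem continuous_checkLoss (hτ : τ ∈ Set.Ioo (0 : ℝ) 1) (x : EuclideanSpace ℝ (Fin d)) (y : ℝ) :
    Continuous fun θ => checkLoss τ θ x y := by
  simp_rw [checkLoss_eq_max hτ]
  fun_prop

theorem checkLoss_sub_le (hτ : τ ∈ Set.Ioo (0 : ℝ) 1) (θ θ₀ x : EuclideanSpace ℝ (Fin d))
    (y : ℝ) : checkLoss τ θ x y - checkLoss τ θ₀ x y ≤ ‖x‖ * ‖θ - θ₀‖ := by
  have h := abs_le.1 (abs_real_inner_le_norm x (θ - θ₀))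
  rw [inner_sub_right] at h
  rw [sub_le_iff_le_add, checkLoss_eq_max hτ, checkLoss_eq_max hτ]
  obtain ⟨h0, h1⟩ := hτ
  have h2 : 0 ≤ ‖x‖ * ‖θ - θ₀‖ := by positivity
  refine max_le ?_ ?_
  · have := le_max_left (τ * (y - inner ℝ x θ₀)) ((τ - 1) * (y - inner ℝ x θ₀))
    nlinarith
  · have := le_max_right (τ * (y - inner ℝ x θ₀)) ((τ - 1) * (y - inner ℝ x θ₀))
    nlinarith

/-- Convexity of the check loss in the parameter, along rays out of `θ₀`. -/
theorem mul_checkLoss_sub_le (hτ : τ ∈ Set.Ioo (0 : ℝ) 1) (θ θ₀ x : EuclideanSpace ℝ (Fin d))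
    (y : ℝ) {s : ℝ} (hs : 1 ≤ s) :
    s * (checkLoss τ θ x y - checkLoss τ θ₀ x y)
      ≤ checkLoss τ (θ₀ + s • (θ - θ₀)) x y - checkLoss τ θ₀ x y := by
  have h : s * checkLoss τ θ x y
      ≤ checkLoss τ (θ₀ + s • (θ - θ₀)) x y + (s - 1) * checkLoss τ θ₀ x y := by
    simp_rw [checkLoss_eq_max hτ, inner_add_right, inner_smul_right, inner_sub_right]
    set a : ℝ := inner ℝ x θ
    set b : ℝ := inner ℝ x θ₀
    rw [mul_max_of_nonneg _ _ (by linarith)]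
    have hs' : 0 ≤ s - 1 := by linarith
    refine max_le ?_ ?_
    · have h1 := le_max_left (τ * (y - (b + s * (a - b)))) ((τ - 1) * (y - (b + s * (a - b))))
      have h2 := mul_le_mul_of_nonneg_left
        (le_max_left (τ * (y - b)) ((τ - 1) * (y - b))) hs'
      linarith
    · have h1 := le_max_right (τ * (y - (b + s * (a - b)))) ((τ - 1) * (y - (b + s * (a - b))))
      have h2 := mul_le_mul_of_nonneg_left
        (le_max_right (τ * (y - b)) ((τ - 1) * (y - b))) hs'
      linarith
  linarith

/-- The derivative of the check loss with respect to the linear predictor, at a residual `e`. -/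
def score (τ e : ℝ) : ℝ :=
  Set.indicator (Set.Iio (0 : ℝ)) 1 e - τ

/-- A lower bound for the remainder of the linear expansion of the check loss: `|v| / 2` for
residuals between `0` and `v / 2`. -/
def bump (v e : ℝ) : ℝ :=
  if (0 ≤ e ∧ e < v / 2) ∨ (v / 2 ≤ e ∧ e < 0) then |v| / 2 else 0

theorem measurable_score (τ : ℝ) : Measurable (score τ) :=
  (measurable_one.indicator measurableSet_Iio).sub_const τ

theorem abs_score_le_one (hτ : τ ∈ Set.Ioo (0 : ℝ) 1) (e : ℝ) : |score τ e| ≤ 1 := by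
  obtain ⟨h0, h1⟩ := hτ
  unfold score
  by_cases h : e ∈ Set.Iio (0 : ℝ)
  · rw [Set.indicator_of_mem h, Pi.one_apply, abs_le]
    constructor <;> linarith
  · rw [Set.indicator_of_notMem h, abs_le]
    constructor <;> linarith

theorem measurable_bump : Measurable fun p : ℝ × ℝ => bump p.1 p.2 := by
  unfold bump
  refine Measurable.ite ?_ (by fun_prop) measurable_const
  exact ((measurableSet_le measurable_const measurable_snd).inter
    (measurableSet_lt measurable_snd (by fun_prop))).union
    ((measurableSet_le (by fun_prop) measurable_snd).inter
    (measurableSet_lt measurable_snd measurable_const))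

theorem bump_nonneg (v e : ℝ) : 0 ≤ bump v e := by
  unfold bump
  split_ifs <;> positivity

theorem bump_le (v e : ℝ) : bump v e ≤ |v| / 2 := by
  unfold bump
  split_ifs
  · rfl
  · positivity

/-- With `e` the residual at `θ₀` and `z` the increment of the predictor, the exact remainder is `|z
- e|` for `e` between `0` and `z`, and zero otherwise. If `v` lies between `0` and `z` and `e`
between `0` and `v / 2`, then `|z - e| ≥ |v| / 2`. -/
theorem score_add_bump_le_checkLoss_sub (hτ : τ ∈ Set.Ioo (0 : ℝ) 1)
    (θ θ₀ x : EuclideanSpace ℝ (Fin d)) (y : ℝ) {v : ℝ}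
    (hv : (0 ≤ v ∧ v ≤ inner ℝ x (θ - θ₀)) ∨ (inner ℝ x (θ - θ₀) ≤ v ∧ v ≤ 0)) :
    inner ℝ x (θ - θ₀) * score τ (y - inner ℝ x θ₀) + bump v (y - inner ℝ x θ₀)
      ≤ checkLoss τ θ x y - checkLoss τ θ₀ x y := by
  rw [checkLoss_eq_max hτ, checkLoss_eq_max hτ]
  rw [inner_sub_right] at hv ⊢
  have he : y - inner ℝ x θ = y - inner ℝ x θ₀ - (inner ℝ x θ - inner ℝ x θ₀) := by ring
  rw [he]
  generalize y - inner ℝ x θ₀ = e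
  generalize (inner ℝ x θ - inner ℝ x θ₀ : ℝ) = z at *
  have h1 := le_max_left (τ * (e - z)) ((τ - 1) * (e - z))
  have h2 := le_max_right (τ * (e - z)) ((τ - 1) * (e - z))
  obtain ⟨h0, h01⟩ := hτ
  unfold score bump
  rcases lt_or_ge e 0 with he | he
  · rw [Set.indicator_of_mem (Set.mem_Iio.2 he), Pi.one_apply,
      max_eq_right (a := τ * e) (by nlinarith)]
    split_ifs with hb
    · rcases hb with hb | hb
      · linarith [hb.1]
      · rw [abs_of_neg (by linarith)]
        rcases hv with hv | hv
        · linarith [hv.1]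
        · nlinarith
    · nlinarith
  · rw [Set.indicator_of_notMem (by simpa using he), max_eq_left (a := τ * e) (by nlinarith)]
    split_ifs with hb
    · rcases hb with hb | hb
      · rw [abs_of_pos (by linarith)]
        rcases hv with hv | hv
        · nlinarith
        · linarith [hv.2]
      · linarith [hb.2]
    · nlinarith

/-- Soft thresholding of `a` at level `b`. -/
def softThreshold (a b : ℝ) : ℝ :=
  max (a - b) 0 - max (-a - b) 0

/-- The soft threshold is the point of `[a - b, a + b]` nearest to `0`. One value of `v` therefore
serves all directions near a given net point. -/
theorem softThreshold_between {a b z : ℝ} (h : |z - a| ≤ b) :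
    (0 ≤ softThreshold a b ∧ softThreshold a b ≤ z) ∨
      (z ≤ softThreshold a b ∧ softThreshold a b ≤ 0) := by
  rw [abs_le] at h
  unfold softThreshold
  rcases le_total (a - b) 0 with h1 | h1 <;> rcases le_total (-a - b) 0 with h2 | h2 <;>
    simp only [max_eq_left, max_eq_right, h1, h2] <;> grind

theorem abs_softThreshold_le {a b : ℝ} (hb : 0 ≤ b) : |softThreshold a b| ≤ |a| := by
  unfold softThreshold
  grind

/-- For `b ≥ 0`, square `|a| ≤ |softThreshold a b| + b`. -/
theorem le_softThreshold_sq (a b : ℝ) : a ^ 2 / 2 - b ^ 2 ≤ softThreshold a b ^ 2 := by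
  unfold softThreshold
  rcases le_total (a - b) 0 with h1 | h1 <;> rcases le_total (-a - b) 0 with h2 | h2 <;>
    simp only [max_eq_left, max_eq_right, h1, h2] <;>
    nlinarith [sq_nonneg (a - 2 * b), sq_nonneg (a + 2 * b)]

theorem measurable_softThreshold : Measurable fun p : ℝ × ℝ => softThreshold p.1 p.2 := by
  unfold softThreshold
  fun_prop

end CheckLoss

/-! ### Conditional distributions with a density that is positive at the quantile -/

section Conditional

/-- Right continuity gives `τ ≤ F(q)`, the left limit gives `F(q-) ≤ τ`, and the two values agree
when there are no atoms. -/
theorem real_Iio_quantile (ν : Measure ℝ) [IsProbabilityMeasure ν] [NullSingletonClass ν] {τ : ℝ}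
    (hτ : τ ∈ Set.Ioo (0 : ℝ) 1) : ν.real (Set.Iio (quantile ν τ)) = τ := by
  set q := quantile ν τ with hq
  have hne : {y : ℝ | τ ≤ cdf ν y}.Nonempty :=
    (((tendsto_cdf_atTop ν).eventually (lt_mem_nhds hτ.2)).exists).imp fun _ h => le_of_lt h
  have hbdd : BddBelow {y : ℝ | τ ≤ cdf ν y} := by
    obtain ⟨b, hb⟩ := ((tendsto_cdf_atBot ν).eventually (gt_mem_nhds hτ.1)).exists
    refine ⟨b, fun y hy => ?_⟩
    by_contra! h
    exact (hb.trans_le hy).not_ge (monotone_cdf ν h.le)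
  have habove : ∀ y, q < y → τ ≤ cdf ν y := fun y hy => by
    obtain ⟨z, hz, hzy⟩ := exists_lt_of_csInf_lt hne hy
    exact le_trans hz (monotone_cdf ν hzy.le)
  have hbelow : ∀ y, y < q → cdf ν y ≤ τ := fun y hy => by
    by_contra! h
    exact (csInf_le hbdd h.le).not_gt hy
  have hge : τ ≤ cdf ν q := by
    refine ge_of_tendsto (((cdf ν).right_continuous q).mono_left
      (nhdsWithin_mono q Set.Ioi_subset_Ici_self)) ?_
    filter_upwards [self_mem_nhdsWithin] with y hy using habove y hy
  have hIic : ν.real (Set.Iic q) = ν.real (Set.Iio q) := by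
    rw [measureReal_def, measureReal_def, measure_congr Iio_ae_eq_Iic]
  have hle : ν.real (Set.Iio q) ≤ τ := by
    have h1 : ν (Set.Iio q) = ENNReal.ofReal (Function.leftLim (cdf ν) q - 0) := by
      conv_lhs => rw [← measure_cdf ν]
      exact StieltjesFunction.measure_Iio _ (tendsto_cdf_atBot ν) q
    rw [measureReal_def, h1]
    refine ENNReal.toReal_le_of_le_ofReal hτ.1.le (ENNReal.ofReal_le_ofReal ?_)
    rw [sub_zero]
    refine le_of_tendsto ((monotone_cdf ν).tendsto_leftLim q) ?_
    filter_upwards [self_mem_nhdsWithin] with y hy using hbelow y hy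
  refine le_antisymm hle ?_
  rw [← hIic, ← cdf_eq_real]
  exact hge

/-- The bump equals `t |v| / 2` on an interval of that same length next to `q`, where the density
exceeds `c / 2` once `t` is small: this yields `(c / 2) (t |v| / 2)² = c t² v² / 8`. -/
theorem eventually_le_lintegral_bump {ν : Measure ℝ} {g : ℝ → ℝ} {q c : ℝ} (hg : Continuous g)
    (hν : ν = volume.withDensity fun y => ENNReal.ofReal (g y)) (hc : 0 < c) (hgq : c ≤ g q)
    (v : ℝ) :
    ∀ᶠ t : ℝ in 𝓝[>] 0, ENNReal.ofReal (c / 8 * v ^ 2)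
      ≤ ∫⁻ y, ENNReal.ofReal (bump (t * v) (y - q) / t ^ 2) ∂ν := by
  rcases eq_or_ne v 0 with rfl | hv
  · simp
  have hv' : 0 < |v| := abs_pos.2 hv
  obtain ⟨s, hs, hsg⟩ := Metric.eventually_nhds_iff.1
    (hg.continuousAt.eventually (lt_mem_nhds (show c / 2 < g q by linarith)))
  have hsmall : ∀ᶠ t : ℝ in 𝓝[>] 0, t < s / |v| :=
    mem_nhdsWithin_of_mem_nhds (Iio_mem_nhds (by positivity))
  filter_upwards [hsmall, self_mem_nhdsWithin] with t ht ht0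
  replace ht0 : 0 < t := ht0
  rw [lt_div_iff₀ hv'] at ht
  obtain ⟨J, hJm, hJvol, hJ⟩ : ∃ J : Set ℝ, MeasurableSet J ∧
      volume J = ENNReal.ofReal (t * |v| / 2) ∧ ∀ y ∈ J, |y - q| < s ∧
        bump (t * v) (y - q) = t * |v| / 2 := by
    have habs : |t * v| = t * |v| := by rw [abs_mul, abs_of_pos ht0]
    rcases hv.lt_or_gt with hneg | hpos
    · rw [abs_of_neg hneg] at *
      refine ⟨Set.Ico (q + t * v / 2) q, measurableSet_Ico, ?_, fun y hy => ⟨?_, ?_⟩⟩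
      · rw [Real.volume_Ico]
        congr 1
        ring
      · have := hy.1
        have := hy.2
        rw [abs_lt]
        constructor <;> linarith
      · unfold bump
        rw [if_pos (Or.inr ⟨by linarith [hy.1], by linarith [hy.2]⟩), habs]
    · rw [abs_of_pos hpos] at *
      refine ⟨Set.Ico q (q + t * v / 2), measurableSet_Ico, ?_, fun y hy => ⟨?_, ?_⟩⟩
      · rw [Real.volume_Ico]
        congr 1
        ring
      · have := hy.1
        have := hy.2
        rw [abs_lt]
        constructor <;> linarith
      · unfold bump
        rw [if_pos (Or.inl ⟨by linarith [hy.1], by linarith [hy.2]⟩), habs]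
  have hνJ : ENNReal.ofReal (c / 2) * ENNReal.ofReal (t * |v| / 2) ≤ ν J := by
    rw [hν, withDensity_apply _ hJm, ← hJvol, ← setLIntegral_const]
    refine setLIntegral_mono (by fun_prop) fun y hy => ENNReal.ofReal_le_ofReal ?_
    exact (hsg (by rw [Real.dist_eq]; exact (hJ y hy).1)).le
  calc ENNReal.ofReal (c / 8 * v ^ 2)
      = ENNReal.ofReal (t * |v| / 2 / t ^ 2)
          * (ENNReal.ofReal (c / 2) * ENNReal.ofReal (t * |v| / 2)) := by
        rw [← ENNReal.ofReal_mul (by positivity), ← ENNReal.ofReal_mul (by positivity)]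
        congr 1
        rw [← sq_abs v]
        field_simp
        norm_num
    _ ≤ ENNReal.ofReal (t * |v| / 2 / t ^ 2) * ν J := by gcongr
    _ = ∫⁻ y in J, ENNReal.ofReal (t * |v| / 2 / t ^ 2) ∂ν := by rw [setLIntegral_const]
    _ = ∫⁻ y in J, ENNReal.ofReal (bump (t * v) (y - q) / t ^ 2) ∂ν :=
        setLIntegral_congr_fun hJm fun y hy => by simp only [(hJ y hy).2]
    _ ≤ _ := setLIntegral_le_lintegral _ _

variable {E : Type*} [MeasurableSpace E] {G : Measure E} [IsProbabilityMeasure G]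
  {κ : Kernel E ℝ} [IsMarkovKernel κ] {q v : E → ℝ}

/-- How small `t` must be depends on `x`, since continuity of the densities is not uniform in `x`.
Fatou's lemma along `t → 0+` needs no uniformity. -/
theorem eventually_le_integral_bump (hq : Measurable q) (hv : Measurable v)
    (hv2 : Integrable (fun x => v x ^ 2) G) {f : E → ℝ → ℝ} {c : ℝ} (hc : 0 < c)
    (hf : ∀ᵐ x ∂G, Continuous (f x) ∧ (∀ y, 0 ≤ f x y) ∧
      κ x = volume.withDensity fun y => ENNReal.ofReal (f x y))
    (hfq : ∀ᵐ x ∂G, c ≤ f x (q x)) {m : ℝ} (hm0 : 0 < m) (hm : m < c / 8 * ∫ x, v x ^ 2 ∂G)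
    (hint : ∀ t : ℝ, Integrable (fun z : E × ℝ => bump (t * v z.1) (z.2 - q z.1)) (G ⊗ₘ κ)) :
    ∀ᶠ t : ℝ in 𝓝[>] 0, m * t ^ 2 ≤ ∫ z, bump (t * v z.1) (z.2 - q z.1) ∂(G ⊗ₘ κ) := by
  have hmeas : ∀ t : ℝ, Measurable fun z : E × ℝ =>
      ENNReal.ofReal (bump (t * v z.1) (z.2 - q z.1) / t ^ 2) := fun t =>
    ((measurable_bump.comp (by fun_prop :
      Measurable fun z : E × ℝ => (t * v z.1, z.2 - q z.1))).div_const _).ennreal_ofReal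
  have hfatou := lintegral_liminf_le (μ := G) (u := 𝓝[>] (0 : ℝ))
    (f := fun t x => ∫⁻ y, ENNReal.ofReal (bump (t * v x) (y - q x) / t ^ 2) ∂(κ x))
    (fun t => (hmeas t).lintegral_kernel_prod_right')
  have hlow : ENNReal.ofReal (c / 8 * ∫ x, v x ^ 2 ∂G)
      ≤ ∫⁻ x, liminf (fun t : ℝ =>
        ∫⁻ y, ENNReal.ofReal (bump (t * v x) (y - q x) / t ^ 2) ∂(κ x)) (𝓝[>] 0) ∂G := by
    rw [← integral_const_mul, ofReal_integral_eq_lintegral_ofReal (hv2.const_mul _)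
      (ae_of_all _ fun x => by positivity)]
    refine lintegral_mono_ae ?_
    filter_upwards [hf, hfq] with x hx hxq
    exact le_liminf_of_le (by isBoundedDefault)
      (eventually_le_lintegral_bump hx.1 hx.2.2 hc hxq (v x))
  have hlt : ENNReal.ofReal m < ENNReal.ofReal (c / 8 * ∫ x, v x ^ 2 ∂G) :=
    (ENNReal.ofReal_lt_ofReal_iff (hm0.trans hm)).2 hm
  filter_upwards [eventually_lt_of_lt_liminf (hlt.trans_le (hlow.trans hfatou)),
    self_mem_nhdsWithin] with t ht ht0
  replace ht0 : 0 < t := ht0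
  rw [← Measure.lintegral_compProd (hmeas t), ← ofReal_integral_eq_lintegral_ofReal
    ((hint t).div_const _) (ae_of_all _ fun z => div_nonneg (bump_nonneg _ _) (sq_nonneg t)),
    integral_div] at ht
  have := (ENNReal.ofReal_lt_ofReal_iff_of_nonneg hm0.le).1 ht
  rw [lt_div_iff₀ (by positivity)] at this
  exact this.le

/-- Given `x`, the score has mean `P(Y < q x) - τ = 0`. -/
theorem integral_mul_score_eq_zero {τ : ℝ} (hτ : τ ∈ Set.Ioo (0 : ℝ) 1)
    (hκ : ∀ᵐ x ∂G, NullSingletonClass (κ x)) (hquant : ∀ᵐ x ∂G, quantile (κ x) τ = q x)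
    (hvi : Integrable (fun z : E × ℝ => v z.1 * score τ (z.2 - q z.1)) (G ⊗ₘ κ)) :
    ∫ z, v z.1 * score τ (z.2 - q z.1) ∂(G ⊗ₘ κ) = 0 := by
  rw [Measure.integral_compProd hvi]
  refine integral_eq_zero_of_ae ?_
  filter_upwards [hκ, hquant] with x hx hxq
  rw [integral_const_mul]
  have h1 : ∀ y, score τ (y - q x) = Set.indicator (Set.Iio (q x)) 1 y - τ := fun y => by
    unfold score
    congr 1
    simp [Set.indicator_apply]
  simp_rw [h1]
  rw [integral_sub ((integrable_const 1).indicator measurableSet_Iio) (integrable_const _),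
    integral_indicator_one measurableSet_Iio, ← hxq, real_Iio_quantile _ hτ]
  simp

end Conditional

/-! ### Chebyshev's inequality for sums over an iid sample -/

theorem measure_le_abs_sum_sub_le {Ω S : Type*} [MeasurableSpace Ω] [MeasurableSpace S]
    {μ : Measure Ω} [IsProbabilityMeasure μ] {P : Measure S} {D : ℕ → Ω → S}
    (hD : ∀ i, Measurable (D i)) (hindep : iIndepFun D μ) (hlaw : ∀ i, μ.map (D i) = P)
    {g : S → ℝ} (hg : Measurable g) (hg2 : MemLp g 2 P) (n : ℕ) {s : ℝ} (hs : 0 < s) :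
    μ {w | s ≤ |∑ i ∈ Finset.range n, g (D i w) - n * ∫ z, g z ∂P|}
      ≤ ENNReal.ofReal (n * (∫ z, g z ^ 2 ∂P) / s ^ 2) := by
  have hP : IsProbabilityMeasure P := hlaw 0 ▸ Measure.isProbabilityMeasure_map (hD 0).aemeasurable
  have hmp : ∀ i, MeasurePreserving (D i) μ P := fun i => ⟨hD i, hlaw i⟩
  have hL : ∀ i, MemLp (fun w => g (D i w)) 2 μ := fun i => hg2.comp_measurePreserving (hmp i)
  have hmean : ∀ i, ∫ w, g (D i w) ∂μ = ∫ z, g z ∂P := fun i => by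
    rw [← hlaw i, integral_map (hD i).aemeasurable hg.aestronglyMeasurable]
  have hsq : ∀ i, ∫ w, g (D i w) ^ 2 ∂μ = ∫ z, g z ^ 2 ∂P := fun i => by
    rw [← hlaw i, integral_map (hD i).aemeasurable (hg.pow_const 2).aestronglyMeasurable]
  have hsum : (∑ i ∈ Finset.range n, fun w => g (D i w))
      = fun w => ∑ i ∈ Finset.range n, g (D i w) := by
    ext w
    simp
  have hSL : MemLp (fun w => ∑ i ∈ Finset.range n, g (D i w)) 2 μ :=
    memLp_finsetSum _ fun i _ => hL i
  have hSmean : ∫ w, ∑ i ∈ Finset.range n, g (D i w) ∂μ = n * ∫ z, g z ∂P := by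
    rw [integral_finsetSum _ fun i _ => (hL i).integrable one_le_two]
    simp [hmean]
  have hvar : Var[fun w => ∑ i ∈ Finset.range n, g (D i w); μ] ≤ n * ∫ z, g z ^ 2 ∂P := by
    rw [← hsum, IndepFun.variance_sum (fun i _ => hL i) fun i _ j _ hij =>
      (hindep.indepFun hij).comp hg hg]
    calc ∑ i ∈ Finset.range n, Var[fun w => g (D i w); μ]
        ≤ ∑ i ∈ Finset.range n, ∫ z, g z ^ 2 ∂P := Finset.sum_le_sum fun i _ => by
          rw [← hsq i]
          exact variance_le_expectation_sq (hL i).aestronglyMeasurable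
      _ = _ := by simp
  have hcheb := meas_ge_le_variance_div_sq hSL hs
  rw [hSmean] at hcheb
  exact hcheb.trans (ENNReal.ofReal_le_ofReal (by gcongr))

/-! ### Second moments of the covariates -/

section SecondMoment

variable {d : ℕ} {G : Measure (EuclideanSpace ℝ (Fin d))}

theorem inner_sq_eq_sum (x u : EuclideanSpace ℝ (Fin d)) :
    (inner ℝ x u : ℝ) ^ 2 = ∑ i, ∑ j, u i * u j * (x i * x j) := by
  rw [sq, PiLp.inner_apply, Finset.sum_mul_sum]
  refine Finset.sum_congr rfl fun i _ => Finset.sum_congr rfl fun j _ => ?_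
  simp only [RCLike.inner_apply, conj_trivial]
  ring

theorem integrable_norm_sq
    (hG : ∀ i j, Integrable (fun x : EuclideanSpace ℝ (Fin d) => x i * x j) G) :
    Integrable (fun x => ‖x‖ ^ 2) G := by
  simp_rw [EuclideanSpace.real_norm_sq_eq, sq]
  exact integrable_finsetSum _ fun i _ => hG i i

theorem integral_inner_sq
    (hG : ∀ i j, Integrable (fun x : EuclideanSpace ℝ (Fin d) => x i * x j) G)
    (u : EuclideanSpace ℝ (Fin d)) :
    ∫ x, (inner ℝ x u : ℝ) ^ 2 ∂G = ∑ i, ∑ j, u i * u j * secondMoment G i j := by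
  simp_rw [inner_sq_eq_sum]
  rw [integral_finsetSum _ fun i _ => integrable_finsetSum _ fun j _ => (hG i j).const_mul _]
  refine Finset.sum_congr rfl fun i _ => ?_
  rw [integral_finsetSum _ fun j _ => (hG i j).const_mul _]
  refine Finset.sum_congr rfl fun j _ => ?_
  rw [integral_const_mul]
  rfl

theorem exists_pos_le_integral_inner_sq
    (hG : ∀ i j, Integrable (fun x : EuclideanSpace ℝ (Fin d) => x i * x j) G)
    (hpos : (secondMoment G).PosDef) :
    ∃ l : ℝ, 0 < l ∧ ∀ u : EuclideanSpace ℝ (Fin d), ‖u‖ = 1 →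
      l ≤ ∫ x, (inner ℝ x u : ℝ) ^ 2 ∂G := by
  have hquad : ∀ u : EuclideanSpace ℝ (Fin d), u ≠ 0 → 0 < ∫ x, (inner ℝ x u : ℝ) ^ 2 ∂G := by
    intro u hu
    have h := hpos.dotProduct_mulVec_pos (x := u.ofLp) (by simpa using hu)
    refine h.trans_eq ?_
    rw [integral_inner_sq hG]
    simp only [dotProduct, Matrix.mulVec, Finset.mul_sum, Pi.star_apply, star_trivial]
    refine Finset.sum_congr rfl fun i _ => Finset.sum_congr rfl fun j _ => ?_
    ring
  have hcont : Continuous fun u : EuclideanSpace ℝ (Fin d) => ∫ x, (inner ℝ x u : ℝ) ^ 2 ∂G := by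
    simp_rw [integral_inner_sq hG]
    fun_prop
  -- The sphere is empty when `d = 0`; otherwise compactness provides a minimizer.
  rcases (Metric.sphere (0 : EuclideanSpace ℝ (Fin d)) 1).eq_empty_or_nonempty with he | hne
  · refine ⟨1, one_pos, fun u hu => ?_⟩
    have : u ∈ Metric.sphere (0 : EuclideanSpace ℝ (Fin d)) 1 := by simpa using hu
    simp [he] at this
  · obtain ⟨u₀, hu₀, hmin⟩ := (isCompact_sphere _ _).exists_isMinOn hne hcont.continuousOn
    refine ⟨_, hquad u₀ ?_, fun u hu => hmin (by simpa using hu)⟩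
    rintro rfl
    simp at hu₀

end SecondMoment

/-! ### Growth of the empirical risk away from the true parameter -/

section Growth

variable {d : ℕ} {τ : ℝ}

/-- The lower bound for the remainder of the check loss in directions within `ρ` of `u`, at
distance `t` from `θ₀`. -/
def netBump (θ₀ u : EuclideanSpace ℝ (Fin d)) (ρ t : ℝ) (z : EuclideanSpace ℝ (Fin d) × ℝ) : ℝ :=
  bump (t * softThreshold (inner ℝ z.1 u) (ρ * ‖z.1‖)) (z.2 - inner ℝ z.1 θ₀)

theorem measurable_softThreshold_inner (u : EuclideanSpace ℝ (Fin d)) (ρ : ℝ) :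
    Measurable fun x : EuclideanSpace ℝ (Fin d) => softThreshold (inner ℝ x u) (ρ * ‖x‖) :=
  measurable_softThreshold.comp (by fun_prop :
    Measurable fun x : EuclideanSpace ℝ (Fin d) => ((inner ℝ x u : ℝ), ρ * ‖x‖))

theorem measurable_netBump (θ₀ u : EuclideanSpace ℝ (Fin d)) (ρ t : ℝ) :
    Measurable (netBump θ₀ u ρ t) :=
  measurable_bump.comp (Measurable.prodMk
    (((measurable_softThreshold_inner u ρ).comp measurable_fst).const_mul t) (by fun_prop))

theorem abs_softThreshold_inner_le {u : EuclideanSpace ℝ (Fin d)} (hu : ‖u‖ = 1) {ρ : ℝ}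
    (hρ : 0 ≤ ρ) (x : EuclideanSpace ℝ (Fin d)) :
    |softThreshold (inner ℝ x u) (ρ * ‖x‖)| ≤ ‖x‖ := by
  refine (abs_softThreshold_le (by positivity)).trans ?_
  simpa [hu] using abs_real_inner_le_norm x u

theorem abs_netBump_le (θ₀ : EuclideanSpace ℝ (Fin d)) {u : EuclideanSpace ℝ (Fin d)}
    (hu : ‖u‖ = 1) {ρ t : ℝ} (hρ : 0 ≤ ρ) (z : EuclideanSpace ℝ (Fin d) × ℝ) :
    |netBump θ₀ u ρ t z| ≤ |t| * ‖z.1‖ := by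
  unfold netBump
  rw [abs_of_nonneg (bump_nonneg _ _)]
  refine (bump_le _ _).trans ?_
  rw [abs_mul]
  have h := mul_le_mul_of_nonneg_left (abs_softThreshold_inner_le hu hρ z.1) (abs_nonneg t)
  have h0 : 0 ≤ |t| * |softThreshold (inner ℝ z.1 u) (ρ * ‖z.1‖)| := by positivity
  linarith

/-- Choose a net point `u` within `ρ` of the direction of `θ - θ₀`. The thresholded predictor along
`u` is then admissible for every observation at once, so finitely many sums control the whole
sphere. The linear part is bounded by coordinates, each of size at most `t`. -/
theorem le_sum_checkLoss_sub_of_net (hτ : τ ∈ Set.Ioo (0 : ℝ) 1)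
    {θ₀ : EuclideanSpace ℝ (Fin d)} {N : Finset (EuclideanSpace ℝ (Fin d))} {ρ : ℝ}
    (hN : ∀ u : EuclideanSpace ℝ (Fin d), ‖u‖ = 1 → ∃ u' ∈ N, ‖u - u'‖ ≤ ρ)
    {n : ℕ} {x : ℕ → EuclideanSpace ℝ (Fin d)} {y : ℕ → ℝ} {t b s : ℝ} (ht : 0 < t)
    (hb : ∀ u ∈ N, b ≤ ∑ i ∈ Finset.range n, netBump θ₀ u ρ t (x i, y i))
    (hs : ∀ k, |∑ i ∈ Finset.range n, x i k * score τ (y i - inner ℝ (x i) θ₀)| ≤ s)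
    {θ : EuclideanSpace ℝ (Fin d)} (hθ : ‖θ - θ₀‖ = t) :
    b - d * (t * s) ≤ ∑ i ∈ Finset.range n,
      (checkLoss τ θ (x i) (y i) - checkLoss τ θ₀ (x i) (y i)) := by
  obtain ⟨u, hu, hclose⟩ := hN (t⁻¹ • (θ - θ₀)) (by
    rw [norm_smul, norm_inv, Real.norm_of_nonneg ht.le, hθ, inv_mul_cancel₀ ht.ne'])
  have hterm : ∀ i, inner ℝ (x i) (θ - θ₀) * score τ (y i - inner ℝ (x i) θ₀)
      + netBump θ₀ u ρ t (x i, y i)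
      ≤ checkLoss τ θ (x i) (y i) - checkLoss τ θ₀ (x i) (y i) := by
    intro i
    refine score_add_bump_le_checkLoss_sub hτ θ θ₀ (x i) (y i) ?_
    have h1 : |(inner ℝ (x i) (t⁻¹ • (θ - θ₀)) : ℝ) - inner ℝ (x i) u| ≤ ρ * ‖x i‖ := by
      rw [← inner_sub_right, mul_comm]
      exact (abs_real_inner_le_norm _ _).trans (by gcongr)
    have h2 : (inner ℝ (x i) (θ - θ₀) : ℝ) = t * inner ℝ (x i) (t⁻¹ • (θ - θ₀)) := by
      rw [inner_smul_right, mul_inv_cancel_left₀ ht.ne']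
    rw [h2]
    rcases softThreshold_between h1 with ⟨h3, h4⟩ | ⟨h3, h4⟩
    · exact Or.inl ⟨by positivity, by gcongr⟩
    · exact Or.inr ⟨by gcongr, mul_nonpos_of_nonneg_of_nonpos ht.le h4⟩
  have hlin : -(d * (t * s))
      ≤ ∑ i ∈ Finset.range n, inner ℝ (x i) (θ - θ₀) * score τ (y i - inner ℝ (x i) θ₀) := by
    have h1 : ∑ i ∈ Finset.range n, inner ℝ (x i) (θ - θ₀) * score τ (y i - inner ℝ (x i) θ₀)
        = ∑ k, (θ - θ₀) k
          * ∑ i ∈ Finset.range n, x i k * score τ (y i - inner ℝ (x i) θ₀) := by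
      simp_rw [Finset.mul_sum]
      rw [Finset.sum_comm]
      refine Finset.sum_congr rfl fun i _ => ?_
      rw [PiLp.inner_apply, Finset.sum_mul]
      refine Finset.sum_congr rfl fun k _ => ?_
      simp only [RCLike.inner_apply, conj_trivial]
      ring
    rw [h1]
    refine neg_le_of_abs_le ((Finset.abs_sum_le_sum_abs _ _).trans ?_)
    calc ∑ k, |(θ - θ₀) k * ∑ i ∈ Finset.range n, x i k * score τ (y i - inner ℝ (x i) θ₀)|
        ≤ ∑ _k : Fin d, t * s := by
          refine Finset.sum_le_sum fun k _ => ?_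
          rw [abs_mul]
          refine mul_le_mul ?_ (hs k) (abs_nonneg _) ht.le
          rw [← hθ]
          exact PiLp.norm_apply_le (θ - θ₀) k
      _ = d * (t * s) := by simp
  calc b - d * (t * s)
      ≤ ∑ i ∈ Finset.range n, inner ℝ (x i) (θ - θ₀) * score τ (y i - inner ℝ (x i) θ₀)
        + ∑ i ∈ Finset.range n, netBump θ₀ u ρ t (x i, y i) := by linarith [hb u hu]
    _ ≤ _ := by
      rw [← Finset.sum_add_distrib]
      exact Finset.sum_le_sum fun i _ => hterm i

variable {Ω : Type*} [MeasurableSpace Ω] {μ : Measure Ω} [IsProbabilityMeasure μ]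
  {G : Measure (EuclideanSpace ℝ (Fin d))} [IsProbabilityMeasure G]
  {κ : Kernel (EuclideanSpace ℝ (Fin d)) ℝ} [IsMarkovKernel κ]

theorem integrable_norm_sq_compProd
    (h2 : Integrable (fun x : EuclideanSpace ℝ (Fin d) => ‖x‖ ^ 2) G) :
    Integrable (fun z : EuclideanSpace ℝ (Fin d) × ℝ => ‖z.1‖ ^ 2) (G ⊗ₘ κ) := by
  have hfst : MeasurePreserving Prod.fst (G ⊗ₘ κ) G := ⟨measurable_fst, Measure.fst_compProd G κ⟩
  exact hfst.integrable_comp_of_integrable h2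

theorem memLp_two_of_abs_le_mul_norm
    (h2 : Integrable (fun x : EuclideanSpace ℝ (Fin d) => ‖x‖ ^ 2) G)
    {g : EuclideanSpace ℝ (Fin d) × ℝ → ℝ} (hg : Measurable g) {C : ℝ}
    (hgC : ∀ z, |g z| ≤ C * ‖z.1‖) : MemLp g 2 (G ⊗ₘ κ) := by
  rw [memLp_two_iff_integrable_sq hg.aestronglyMeasurable]
  refine ((integrable_norm_sq_compProd (κ := κ) h2).const_mul (C ^ 2)).mono'
    (hg.pow_const 2).aestronglyMeasurable (ae_of_all _ fun z => ?_)
  rw [Real.norm_of_nonneg (sq_nonneg _), ← sq_abs, ← mul_pow]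
  exact pow_le_pow_left₀ (abs_nonneg _) (hgC z) 2

theorem integral_sq_le_of_abs_le_mul_norm
    (h2 : Integrable (fun x : EuclideanSpace ℝ (Fin d) => ‖x‖ ^ 2) G)
    {g : EuclideanSpace ℝ (Fin d) × ℝ → ℝ} (hg : Measurable g) {C : ℝ}
    (hgC : ∀ z, |g z| ≤ C * ‖z.1‖) :
    ∫ z, g z ^ 2 ∂(G ⊗ₘ κ) ≤ C ^ 2 * ∫ x, ‖x‖ ^ 2 ∂G := by
  have h3 : ∫ x, ‖x‖ ^ 2 ∂G
      = ∫ z : EuclideanSpace ℝ (Fin d) × ℝ, ‖z.1‖ ^ 2 ∂(G ⊗ₘ κ) := by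
    conv_lhs => rw [← Measure.fst_compProd G κ, Measure.fst]
    exact integral_map measurable_fst.aemeasurable (by fun_prop)
  rw [h3, ← integral_const_mul]
  refine integral_mono (memLp_two_of_abs_le_mul_norm h2 hg hgC).integrable_sq
    ((integrable_norm_sq_compProd h2).const_mul _) fun z => ?_
  simp only
  rw [← sq_abs, ← mul_pow]
  exact pow_le_pow_left₀ (abs_nonneg _) (hgC z) 2

theorem measure_le_abs_sum_sub_le_of_abs_le_mul_norm
    {X : ℕ → Ω → EuclideanSpace ℝ (Fin d)} {Y : ℕ → Ω → ℝ}
    (hX : ∀ i, Measurable (X i)) (hY : ∀ i, Measurable (Y i))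
    (hindep : iIndepFun (fun i w => (X i w, Y i w)) μ)
    (hlaw : ∀ i, μ.map (fun w => (X i w, Y i w)) = G ⊗ₘ κ)
    (h2 : Integrable (fun x : EuclideanSpace ℝ (Fin d) => ‖x‖ ^ 2) G)
    {g : EuclideanSpace ℝ (Fin d) × ℝ → ℝ} (hg : Measurable g) {C : ℝ}
    (hgC : ∀ z, |g z| ≤ C * ‖z.1‖) (n : ℕ) {s : ℝ} (hs : 0 < s) :
    μ {w | s ≤ |∑ i ∈ Finset.range n, g (X i w, Y i w) - n * ∫ z, g z ∂(G ⊗ₘ κ)|}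
      ≤ ENNReal.ofReal (n * (C ^ 2 * ∫ x, ‖x‖ ^ 2 ∂G) / s ^ 2) := by
  refine (measure_le_abs_sum_sub_le (fun i => (hX i).prodMk (hY i)) hindep hlaw hg
    (memLp_two_of_abs_le_mul_norm h2 hg hgC) n hs).trans (ENNReal.ofReal_le_ofReal ?_)
  gcongr
  exact integral_sq_le_of_abs_le_mul_norm h2 hg hgC

/-- Thresholding leaves a second moment of at least `l / 2 - l / 4 = l / 4`. -/
theorem eventually_le_integral_netBump {θ₀ : EuclideanSpace ℝ (Fin d)}
    {f : EuclideanSpace ℝ (Fin d) → ℝ → ℝ} {c : ℝ} (hc : 0 < c)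
    (hf : ∀ᵐ x ∂G, Continuous (f x) ∧ (∀ y, 0 ≤ f x y) ∧
      κ x = volume.withDensity fun y => ENNReal.ofReal (f x y))
    (hfq : ∀ᵐ x ∂G, c ≤ f x (inner ℝ x θ₀))
    (h2 : Integrable (fun x : EuclideanSpace ℝ (Fin d) => ‖x‖ ^ 2) G)
    {u : EuclideanSpace ℝ (Fin d)} (hu : ‖u‖ = 1) {l ρ m : ℝ}
    (hl : l ≤ ∫ x, (inner ℝ x u : ℝ) ^ 2 ∂G) (hρ0 : 0 ≤ ρ)
    (hρ : ρ ^ 2 * ∫ x, ‖x‖ ^ 2 ∂G ≤ l / 4) (hm0 : 0 < m) (hm : m < c / 8 * (l / 4)) :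
    ∀ᶠ t : ℝ in 𝓝[>] 0, m * t ^ 2 ≤ ∫ z, netBump θ₀ u ρ t z ∂(G ⊗ₘ κ) := by
  have hvm := measurable_softThreshold_inner u ρ
  have hv2 : Integrable (fun x : EuclideanSpace ℝ (Fin d) =>
      softThreshold (inner ℝ x u) (ρ * ‖x‖) ^ 2) G := by
    refine h2.mono' (hvm.pow_const 2).aestronglyMeasurable (ae_of_all _ fun x => ?_)
    rw [Real.norm_of_nonneg (sq_nonneg _), ← sq_abs]
    exact pow_le_pow_left₀ (abs_nonneg _) (abs_softThreshold_inner_le hu hρ0 x) 2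
  have hin : Integrable (fun x : EuclideanSpace ℝ (Fin d) => (inner ℝ x u : ℝ) ^ 2) G := by
    refine h2.mono' (by fun_prop) (ae_of_all _ fun x => ?_)
    rw [Real.norm_of_nonneg (sq_nonneg _), ← sq_abs]
    exact pow_le_pow_left₀ (abs_nonneg _) (by simpa [hu] using abs_real_inner_le_norm x u) 2
  have hlow : l / 4 ≤ ∫ x, softThreshold (inner ℝ x u) (ρ * ‖x‖) ^ 2 ∂G := by
    calc l / 4 ≤ (∫ x, (inner ℝ x u : ℝ) ^ 2 ∂G) / 2 - ρ ^ 2 * ∫ x, ‖x‖ ^ 2 ∂G := by linarith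
      _ = ∫ x, ((inner ℝ x u : ℝ) ^ 2 / 2 - ρ ^ 2 * ‖x‖ ^ 2) ∂G := by
        rw [integral_sub (hin.div_const _) (h2.const_mul _), integral_div, integral_const_mul]
      _ ≤ _ := by
        refine integral_mono ((hin.div_const _).sub (h2.const_mul _)) hv2 fun x => ?_
        simp only
        rw [← mul_pow]
        exact le_softThreshold_sq _ _
  exact eventually_le_integral_bump (by fun_prop) hvm hv2 hc hf hfq hm0
    (hm.trans_le (by gcongr)) fun t =>
      (memLp_two_of_abs_le_mul_norm h2 (measurable_netBump θ₀ u ρ t)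
        (abs_netBump_le θ₀ hu hρ0)).integrable one_le_two

end Growth

/-! ### Growth on the small sphere with high probability, and the resulting posterior bound -/

section Assembly

theorem tendsto_div_sqrt_nhdsGT_zero {K : ℝ} (hK : 0 < K) :
    Tendsto (fun n : ℕ => K / √(n : ℝ)) atTop (𝓝[>] 0) := by
  refine tendsto_nhdsWithin_iff.2 ⟨?_, ?_⟩
  · exact tendsto_const_nhds.div_atTop
      (Real.tendsto_sqrt_atTop.comp tendsto_natCast_atTop_atTop)
  · filter_upwards [eventually_gt_atTop 0] with n hn
    have : (0 : ℝ) < n := by exact_mod_cast hn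
    exact div_pos hK (Real.sqrt_pos.2 this)

variable {d : ℕ} {τ : ℝ} {Ω : Type*} [MeasurableSpace Ω] {μ : Measure Ω} [IsProbabilityMeasure μ]
  {G : Measure (EuclideanSpace ℝ (Fin d))} [IsProbabilityMeasure G]
  {κ : Kernel (EuclideanSpace ℝ (Fin d)) ℝ} [IsMarkovKernel κ]

/-- With probability close to one, the excess empirical risk is bounded away from zero on a sphere
of radius proportional to `n ^ (-1/2)` around the true parameter. -/
theorem exists_eventually_measure_compl_growth_le (hτ : τ ∈ Set.Ioo (0 : ℝ) 1)
    {X : ℕ → Ω → EuclideanSpace ℝ (Fin d)} {Y : ℕ → Ω → ℝ}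
    (hX : ∀ i, Measurable (X i)) (hY : ∀ i, Measurable (Y i))
    (hindep : iIndepFun (fun i w => (X i w, Y i w)) μ)
    (hlaw : ∀ i, μ.map (fun w => (X i w, Y i w)) = G ⊗ₘ κ)
    {θ₀ : EuclideanSpace ℝ (Fin d)}
    (hmodel : ∀ᵐ x ∂G, quantile (κ x) τ = inner ℝ x θ₀)
    (hG : ∀ i j, Integrable (fun x : EuclideanSpace ℝ (Fin d) => x i * x j) G)
    (hpos : (secondMoment G).PosDef)
    {f : EuclideanSpace ℝ (Fin d) → ℝ → ℝ}
    (hf : ∀ᵐ x ∂G, Continuous (f x) ∧ (∀ y, 0 ≤ f x y) ∧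
      κ x = volume.withDensity fun y => ENNReal.ofReal (f x y))
    {c : ℝ} (hc : 0 < c) (hfq : ∀ᵐ x ∂G, c ≤ f x (inner ℝ x θ₀)) {ε : ℝ} (hε : 0 < ε) :
    ∃ K B L : ℝ, 0 < K ∧ 0 < B ∧ 0 ≤ L ∧ ∀ᶠ n : ℕ in atTop,
      μ {w | ¬ ((∀ θ, ‖θ - θ₀‖ = K / √(n : ℝ) → B ≤ ∑ i ∈ Finset.range n,
          (checkLoss τ θ (X i w) (Y i w) - checkLoss τ θ₀ (X i w) (Y i w))) ∧
        ∑ i ∈ Finset.range n, ‖X i w‖ ≤ n * L)} ≤ ENNReal.ofReal ε := by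
  have h2 := integrable_norm_sq hG
  obtain ⟨l, hl, hlu⟩ := exists_pos_le_integral_inner_sq hG hpos
  set S := ∫ x, ‖x‖ ^ 2 ∂G with hS
  have hS0 : 0 ≤ S := integral_nonneg fun x => sq_nonneg _
  obtain ⟨ρ, hρ, hρS⟩ : ∃ ρ : ℝ, 0 < ρ ∧ ρ ^ 2 * S ≤ l / 4 := by
    refine ⟨√(l / (4 * (S + 1))), by positivity, ?_⟩
    rw [Real.sq_sqrt (by positivity), div_mul_eq_mul_div,
      div_le_div_iff₀ (by positivity) (by norm_num)]
    nlinarith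
  obtain ⟨N, hNs, hNcover⟩ : ∃ N : Finset (EuclideanSpace ℝ (Fin d)), (∀ u ∈ N, ‖u‖ = 1) ∧
      ∀ u : EuclideanSpace ℝ (Fin d), ‖u‖ = 1 → ∃ u' ∈ N, ‖u - u'‖ ≤ ρ := by
    obtain ⟨T, hTs, hTf, hT⟩ :=
      (isCompact_sphere (0 : EuclideanSpace ℝ (Fin d)) 1).finite_cover_balls hρ
    refine ⟨hTf.toFinset, fun u hu => by simpa using hTs (hTf.mem_toFinset.1 hu), fun u hu => ?_⟩
    obtain ⟨u', hu', hball⟩ := Set.mem_iUnion₂.1 (hT (show u ∈ Metric.sphere 0 1 by simpa using hu))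
    exact ⟨u', hTf.mem_toFinset.2 hu', (mem_ball_iff_norm.1 hball).le⟩
  obtain ⟨m, hm0, hm⟩ : ∃ m : ℝ, 0 < m ∧ m < c / 8 * (l / 4) :=
    exists_between (by positivity)
  -- `Q / K ^ 2` collects the Chebyshev bounds for the bump sums over the net and for the `d` score
  -- coordinates.
  set Q : ℝ := N.card * (4 * S / m ^ 2) + d * (16 * (d + 1) ^ 2 * S / m ^ 2) with hQ
  have hQ0 : 0 ≤ Q := by positivity
  obtain ⟨K, hK1, hKQ⟩ : ∃ K : ℝ, 1 ≤ K ∧ Q / K ^ 2 ≤ ε / 2 := by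
    refine ⟨max 1 (2 * Q / ε), le_max_left _ _, ?_⟩
    have h1 := le_max_left 1 (2 * Q / ε)
    have h3 := (div_le_iff₀ hε).1 (le_max_right 1 (2 * Q / ε))
    rw [div_le_iff₀ (by positivity)]
    nlinarith [mul_le_mul_of_nonneg_left h1 (by positivity : 0 ≤ max 1 (2 * Q / ε) * ε)]
  have hK : 0 < K := one_pos.trans_le hK1
  set A := ∫ z : EuclideanSpace ℝ (Fin d) × ℝ, ‖z.1‖ ∂(G ⊗ₘ κ) with hA
  have hA0 : 0 ≤ A := integral_nonneg fun z => norm_nonneg _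
  -- The bump sums have mean at least `K² m`; a deviation of `K² m / 2` and a linear part of at most
  -- `K² m / 4` leave `K² m / 4`.
  refine ⟨K, K ^ 2 * m / 4, A + 1, hK, by positivity, by positivity, ?_⟩
  have hbumps : ∀ᶠ n : ℕ in atTop, ∀ u ∈ N, m * (K / √(n : ℝ)) ^ 2
      ≤ ∫ z, netBump θ₀ u ρ (K / √(n : ℝ)) z ∂(G ⊗ₘ κ) := by
    rw [Finset.eventually_all]
    intro u hu
    exact (tendsto_div_sqrt_nhdsGT_zero hK).eventually (eventually_le_integral_netBump hc hf hfq h2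
      (hNs u hu) (hlu u (hNs u hu)) hρ.le hρS hm0 hm)
  have hSn : ∀ᶠ n : ℕ in atTop, S / n ≤ ε / 2 :=
    (tendsto_const_nhds.div_atTop tendsto_natCast_atTop_atTop).eventually
      (ge_mem_nhds (by positivity))
  filter_upwards [hbumps, hSn, eventually_gt_atTop 0] with n hbump hSn hn
  have hn0 : (0 : ℝ) < n := by exact_mod_cast hn
  have hsqrt : 0 < √(n : ℝ) := Real.sqrt_pos.2 hn0
  have hsq : √(n : ℝ) ^ 2 = n := Real.sq_sqrt hn0.le
  set t := K / √(n : ℝ) with ht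
  have ht0 : 0 < t := div_pos hK hsqrt
  have hnt : n * t ^ 2 = K ^ 2 := by
    rw [ht, div_pow, hsq]
    field_simp
  -- Chosen so that `d t s = (K² m / 4) · d / (d + 1)`; the `+ 1` keeps the denominator nonzero.
  set s := K * m / (4 * (d + 1)) * √(n : ℝ) with hs
  have hs0 : 0 < s := by positivity
  have hscore_meas : ∀ k, Measurable fun z : EuclideanSpace ℝ (Fin d) × ℝ =>
      z.1 k * score τ (z.2 - inner ℝ z.1 θ₀) := fun k =>
    (by fun_prop : Measurable fun z : EuclideanSpace ℝ (Fin d) × ℝ => z.1 k).mul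
      ((measurable_score τ).comp (by fun_prop))
  have hscore_le : ∀ k, ∀ z : EuclideanSpace ℝ (Fin d) × ℝ,
      |z.1 k * score τ (z.2 - inner ℝ z.1 θ₀)| ≤ 1 * ‖z.1‖ := fun k z => by
    rw [abs_mul, one_mul]
    calc |z.1 k| * |score τ (z.2 - inner ℝ z.1 θ₀)| ≤ ‖z.1‖ * 1 :=
          mul_le_mul (PiLp.norm_apply_le z.1 k) (abs_score_le_one hτ _) (abs_nonneg _)
            (norm_nonneg _)
      _ = ‖z.1‖ := mul_one _
  have hscore_mean : ∀ k, ∫ z : EuclideanSpace ℝ (Fin d) × ℝ,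
      z.1 k * score τ (z.2 - inner ℝ z.1 θ₀) ∂(G ⊗ₘ κ) = 0 := fun k =>
    integral_mul_score_eq_zero (q := fun x => inner ℝ x θ₀) (v := fun x => x k) hτ
      (by
        filter_upwards [hf] with x hx
        rw [hx.2.2]
        infer_instance) hmodel
      ((memLp_two_of_abs_le_mul_norm h2 (hscore_meas k) (hscore_le k)).integrable one_le_two)
  set bad₁ : EuclideanSpace ℝ (Fin d) → Set Ω := fun u =>
    {w | n * m * t ^ 2 / 2 ≤ |∑ i ∈ Finset.range n, netBump θ₀ u ρ t (X i w, Y i w)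
      - n * ∫ z, netBump θ₀ u ρ t z ∂(G ⊗ₘ κ)|} with hbad₁
  set bad₂ : Fin d → Set Ω := fun k =>
    {w | s ≤ |∑ i ∈ Finset.range n, X i w k * score τ (Y i w - inner ℝ (X i w) θ₀)
      - n * ∫ z : EuclideanSpace ℝ (Fin d) × ℝ,
        z.1 k * score τ (z.2 - inner ℝ z.1 θ₀) ∂(G ⊗ₘ κ)|} with hbad₂
  set bad₃ : Set Ω := {w | (n : ℝ) ≤ |∑ i ∈ Finset.range n, ‖X i w‖ - n * A|} with hbad₃
  have hμ₁ : ∀ u ∈ N, μ (bad₁ u) ≤ ENNReal.ofReal (4 * S / m ^ 2 / K ^ 2) := fun u hu => by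
    refine (measure_le_abs_sum_sub_le_of_abs_le_mul_norm hX hY hindep hlaw h2
      (measurable_netBump θ₀ u ρ t) (abs_netBump_le θ₀ (hNs u hu) hρ.le) n
      (by positivity)).trans (ENNReal.ofReal_le_ofReal (le_of_eq ?_))
    rw [sq_abs, ← hnt, ← hS]
    field_simp
    norm_num
  have hμ₂ : ∀ k, μ (bad₂ k) ≤ ENNReal.ofReal (16 * (d + 1) ^ 2 * S / m ^ 2 / K ^ 2) := fun k => by
    refine (measure_le_abs_sum_sub_le_of_abs_le_mul_norm hX hY hindep hlaw h2
      (hscore_meas k) (hscore_le k) n hs0).trans (ENNReal.ofReal_le_ofReal (le_of_eq ?_))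
    rw [hs, mul_pow, hsq, ← hS]
    field_simp
    norm_num
  have hμ₃ : μ bad₃ ≤ ENNReal.ofReal (ε / 2) := by
    refine (measure_le_abs_sum_sub_le_of_abs_le_mul_norm hX hY hindep hlaw h2
      (g := fun z => ‖z.1‖) (C := 1) (by fun_prop) (fun z => by simp) n hn0).trans
      (ENNReal.ofReal_le_ofReal (le_trans (le_of_eq ?_) hSn))
    rw [← hS]
    field_simp
  have hsub : {w | ¬ ((∀ θ, ‖θ - θ₀‖ = t → K ^ 2 * m / 4 ≤ ∑ i ∈ Finset.range n,
          (checkLoss τ θ (X i w) (Y i w) - checkLoss τ θ₀ (X i w) (Y i w))) ∧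
        ∑ i ∈ Finset.range n, ‖X i w‖ ≤ n * (A + 1))}
      ⊆ ((⋃ u ∈ N, bad₁ u) ∪ ⋃ k ∈ (Finset.univ : Finset (Fin d)), bad₂ k) ∪ bad₃ := by
    intro w hw
    by_contra hgood
    simp only [Set.mem_union, Set.mem_iUnion, not_or, not_exists] at hgood
    obtain ⟨⟨hg₁, hg₂⟩, hg₃⟩ := hgood
    refine hw ⟨fun θ hθ => ?_, ?_⟩
    · have h := le_sum_checkLoss_sub_of_net hτ hNcover (n := n) (x := fun i => X i w)
        (y := fun i => Y i w) (b := K ^ 2 * m / 2) (s := s) ht0 (fun u hu => ?_) (fun k => ?_) hθ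
      · have h3 : d * (t * s) ≤ K ^ 2 * m / 4 := by
          have h4 : d * (t * s) = K ^ 2 * m / 4 * (d / (d + 1)) := by
            rw [hs, ht]
            field_simp
          rw [h4]
          refine mul_le_of_le_one_right (by positivity) ?_
          rw [div_le_one (by positivity)]
          linarith
        linarith
      · have h1 : |∑ i ∈ Finset.range n, netBump θ₀ u ρ t (X i w, Y i w)
            - n * ∫ z, netBump θ₀ u ρ t z ∂(G ⊗ₘ κ)| < n * m * t ^ 2 / 2 :=
          not_le.1 (hg₁ u hu)
        have h3 := mul_le_mul_of_nonneg_left (hbump u hu) hn0.le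
        have h4 : n * (m * t ^ 2) = K ^ 2 * m := by rw [← hnt]; ring
        have h5 : n * m * t ^ 2 / 2 = K ^ 2 * m / 2 := by rw [← hnt]; ring
        linarith [(abs_lt.1 h1).1]
      · have h1 : |∑ i ∈ Finset.range n, X i w k * score τ (Y i w - inner ℝ (X i w) θ₀)
            - n * ∫ z : EuclideanSpace ℝ (Fin d) × ℝ,
              z.1 k * score τ (z.2 - inner ℝ z.1 θ₀) ∂(G ⊗ₘ κ)| < s :=
          not_le.1 (hg₂ k (Finset.mem_univ k))
        rw [hscore_mean, mul_zero, sub_zero] at h1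
        exact h1.le
    · have h1 : |∑ i ∈ Finset.range n, ‖X i w‖ - n * A| < n := not_le.1 hg₃
      linarith [(abs_lt.1 h1).2]
  have hcombine : (N.card : ENNReal) * ENNReal.ofReal (4 * S / m ^ 2 / K ^ 2)
      + (d : ENNReal) * ENNReal.ofReal (16 * (d + 1) ^ 2 * S / m ^ 2 / K ^ 2)
      = ENNReal.ofReal (Q / K ^ 2) := by
    rw [← ENNReal.ofReal_natCast, ← ENNReal.ofReal_natCast, ← ENNReal.ofReal_mul (by positivity),
      ← ENNReal.ofReal_mul (by positivity), ← ENNReal.ofReal_add (by positivity) (by positivity)]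
    congr 1
    rw [hQ]
    ring
  calc _ ≤ μ (((⋃ u ∈ N, bad₁ u) ∪ ⋃ k ∈ (Finset.univ : Finset (Fin d)), bad₂ k) ∪ bad₃) :=
        measure_mono hsub
    _ ≤ (∑ u ∈ N, μ (bad₁ u) + ∑ k, μ (bad₂ k)) + μ bad₃ := by
        refine (measure_union_le _ _).trans (add_le_add_left ((measure_union_le _ _).trans ?_) _)
        exact add_le_add (measure_biUnion_finset_le _ _) (measure_biUnion_finset_le _ _)
    _ ≤ (∑ _u ∈ N, ENNReal.ofReal (4 * S / m ^ 2 / K ^ 2)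
          + ∑ _k : Fin d, ENNReal.ofReal (16 * (d + 1) ^ 2 * S / m ^ 2 / K ^ 2))
          + ENNReal.ofReal (ε / 2) := by
        gcongr with u hu k
        · exact hμ₁ u hu
        · exact hμ₂ k
    _ = ENNReal.ofReal (Q / K ^ 2) + ENNReal.ofReal (ε / 2) := by
        rw [← hcombine]
        simp
    _ ≤ ENNReal.ofReal (ε / 2) + ENNReal.ofReal (ε / 2) := by gcongr
    _ = ENNReal.ofReal ε := by
        rw [← ENNReal.ofReal_add (by positivity) (by positivity), add_halves]

/-- Normalization absorbs the loss at `θ₀`, which does not depend on `θ`. -/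
theorem gibbsPosterior_eq_tilted_sub {ω : ℝ} {Pri : Measure (EuclideanSpace ℝ (Fin d))}
    [IsProbabilityMeasure Pri] (θ₀ : EuclideanSpace ℝ (Fin d)) {n : ℕ} (hn : 0 < n)
    (x : ℕ → EuclideanSpace ℝ (Fin d)) (y : ℕ → ℝ) :
    gibbsPosterior τ ω Pri n x y = Pri.tilted fun θ => -(ω * ∑ i ∈ Finset.range n,
      (checkLoss τ θ (x i) (y i) - checkLoss τ θ₀ (x i) (y i))) := by
  have hn0 : (n : ℝ) ≠ 0 := by exact_mod_cast hn.ne'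
  rw [gibbsPosterior,
    ← tilted_const_add Pri (-(ω * ∑ i ∈ Finset.range n, checkLoss τ θ₀ (x i) (y i)))
      fun θ => -(ω * ∑ i ∈ Finset.range n,
        (checkLoss τ θ (x i) (y i) - checkLoss τ θ₀ (x i) (y i)))]
  congr 1
  ext θ
  rw [empiricalRisk, Finset.sum_sub_distrib]
  field_simp
  ring

theorem tendsto_posterior_bound {a : ℕ → ℝ} (ha : Tendsto a atTop atTop) {b₁ b₂ : ℝ}
    (hb₁ : 0 < b₁) (hb₂ : 0 < b₂) (A₁ A₂ : ℝ) (k : ℕ) :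
    Tendsto (fun n : ℕ => A₁ * Real.exp (-(b₁ * a n))
      + A₂ * ((n : ℝ) ^ k * Real.exp (-(b₂ * √(n : ℝ))))) atTop (𝓝 0) := by
  have h1 : Tendsto (fun n : ℕ => Real.exp (-(b₁ * a n))) atTop (𝓝 0) :=
    Real.tendsto_exp_neg_atTop_nhds_zero.comp (ha.const_mul_atTop hb₁)
  have h2 : Tendsto (fun n : ℕ => (n : ℝ) ^ k * Real.exp (-(b₂ * √(n : ℝ)))) atTop (𝓝 0) := by
    -- In terms of `u = b₂ √n`, the power `n ^ k` is `u ^ (2 k) / b₂ ^ (2 k)`.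
    have h3 := (Real.tendsto_pow_mul_exp_neg_atTop_nhds_zero (2 * k)).comp
      ((Real.tendsto_sqrt_atTop.comp tendsto_natCast_atTop_atTop).const_mul_atTop hb₂)
    have h4 := h3.const_mul ((b₂ ^ (2 * k))⁻¹)
    rw [mul_zero] at h4
    refine h4.congr fun n => ?_
    simp only [Function.comp_apply]
    rw [mul_pow, pow_mul (√(n : ℝ)), Real.sq_sqrt (Nat.cast_nonneg n)]
    field_simp
  simpa using (h1.const_mul A₁).add (h2.const_mul A₂)

/-- A deterministic bound for the Gibbs posterior mass of the complement of a ball. -/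
theorem gibbsPosterior_real_le (hτ : τ ∈ Set.Ioo (0 : ℝ) 1) {ω : ℝ} (hω : 0 < ω)
    {Pri : Measure (EuclideanSpace ℝ (Fin d))} [IsProbabilityMeasure Pri]
    {θ₀ : EuclideanSpace ℝ (Fin d)} {n : ℕ} (hn : 0 < n)
    {x : ℕ → EuclideanSpace ℝ (Fin d)} {y : ℕ → ℝ} {K B L a δ c C : ℝ}
    (hK : 0 < K) (hB : 0 < B) (hL : 0 ≤ L) (hc : 0 < c) (hC : 0 < C)
    (hlow : ENNReal.ofReal c • volume.restrict (Metric.closedBall θ₀ δ)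
      ≤ Pri.restrict (Metric.closedBall θ₀ δ))
    (hup : Pri.restrict (Metric.closedBall θ₀ δ)
      ≤ ENNReal.ofReal C • volume.restrict (Metric.closedBall θ₀ δ))
    (hsphere : ∀ θ, ‖θ - θ₀‖ = K / √(n : ℝ) → B ≤ ∑ i ∈ Finset.range n,
      (checkLoss τ θ (x i) (y i) - checkLoss τ θ₀ (x i) (y i)))
    (hx : ∑ i ∈ Finset.range n, ‖x i‖ ≤ n * L)
    (ha : 2 * K ≤ a) (hKδ : K / √(n : ℝ) ≤ δ) (hnδ : (n : ℝ)⁻¹ ≤ δ) :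
    (gibbsPosterior τ ω Pri n x y).real {θ | a * (n : ℝ) ^ (-(1 / 2) : ℝ) < ‖θ - θ₀‖}
      ≤ C / c * 2 ^ d * Real.exp (-(ω * B / (2 * K) * a))
        + Real.exp (ω * L) / (c * volume.real (Metric.ball (0 : EuclideanSpace ℝ (Fin d)) 1))
          * ((n : ℝ) ^ d * Real.exp (-(ω * B * δ / K * √(n : ℝ)))) := by
  have hn0 : (0 : ℝ) < n := by exact_mod_cast hn
  have hsqrt : 0 < √(n : ℝ) := Real.sqrt_pos.2 hn0
  have hrad : a * (n : ℝ) ^ (-(1 / 2) : ℝ) = a / √(n : ℝ) := by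
    rw [Real.rpow_neg hn0.le, ← Real.sqrt_eq_rpow, div_eq_mul_inv]
  set M : EuclideanSpace ℝ (Fin d) → ℝ := fun θ => ∑ i ∈ Finset.range n,
    (checkLoss τ θ (x i) (y i) - checkLoss τ θ₀ (x i) (y i)) with hM
  have hMcont : Continuous M :=
    continuous_finsetSum _ fun i _ => (continuous_checkLoss hτ _ _).sub continuous_const
  have hint : Integrable (fun θ => Real.exp (-(ω * M θ))) Pri := by
    refine Integrable.of_bound (by fun_prop)
      (Real.exp (ω * ∑ i ∈ Finset.range n, checkLoss τ θ₀ (x i) (y i))) (ae_of_all _ fun θ => ?_)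
    rw [Real.norm_of_nonneg (Real.exp_pos _).le, Real.exp_le_exp, ← mul_neg]
    refine mul_le_mul_of_nonneg_left ?_ hω.le
    have : 0 ≤ ∑ i ∈ Finset.range n, checkLoss τ θ (x i) (y i) :=
      Finset.sum_nonneg fun i _ => checkLoss_nonneg _ _ _ _
    simp only [hM, Finset.sum_sub_distrib]
    linarith
  have hray : ∀ θ, ∀ s : ℝ, 1 ≤ s → s * M θ ≤ M (θ₀ + s • (θ - θ₀)) := fun θ s hs => by
    simp only [hM, Finset.mul_sum]
    exact Finset.sum_le_sum fun i _ => mul_checkLoss_sub_le hτ θ θ₀ (x i) (y i) hs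
  have hMH : ∀ θ, M θ ≤ n * L * ‖θ - θ₀‖ := fun θ =>
    calc M θ ≤ ∑ i ∈ Finset.range n, ‖x i‖ * ‖θ - θ₀‖ :=
          Finset.sum_le_sum fun i _ => checkLoss_sub_le hτ θ θ₀ (x i) (y i)
      _ = (∑ i ∈ Finset.range n, ‖x i‖) * ‖θ - θ₀‖ := by rw [Finset.sum_mul]
      _ ≤ _ := by gcongr
  rw [gibbsPosterior_eq_tilted_sub θ₀ hn, hrad]
  -- The Lipschitz constant of `M` at `θ₀` is at most `n L`, so on the ball of radius `1 / n` the
  -- potential stays below `L`, while the volume shrinks only like `n ^ (-d)`.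
  refine (tilted_real_setOf_lt_norm_le (vol := volume) (t := K / √(n : ℝ)) (s := (n : ℝ)⁻¹)
    (by positivity) hB hω hMcont.measurable hint hray hsphere (by
      rw [← mul_div_assoc]
      gcongr) hKδ (by positivity) hMH (by positivity) hnδ hc hC hlow hup).trans (le_of_eq ?_)
  rw [finrank_euclideanSpace_fin]
  congr 1
  · congr 3
    field_simp
  · rw [mul_right_comm (n : ℝ), mul_inv_cancel₀ hn0.ne', one_mul, inv_pow]
    have h1 : ω * B * δ / (K / √(n : ℝ)) = ω * B * δ / K * √(n : ℝ) := by field_simp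
    rw [h1]
    field_simp

end Assembly

end QuantReg

end

theorem proposition2 {Ω : Type*} [MeasurableSpace Ω] (μ : Measure Ω) [IsProbabilityMeasure μ]
    (p : ℕ) (τ : ℝ) (hτ : τ ∈ Set.Ioo (0 : ℝ) 1)
    -- `G` is the marginal law of `X`, `κ x` the conditional law of `Y` given `X = x`
    (G : Measure (EuclideanSpace ℝ (Fin (p + 1)))) [IsProbabilityMeasure G]
    (κ : Kernel (EuclideanSpace ℝ (Fin (p + 1))) ℝ) [IsMarkovKernel κ]
    -- the data are iid
    (X : ℕ → Ω → EuclideanSpace ℝ (Fin (p + 1))) (Y : ℕ → Ω → ℝ)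
    (hX : ∀ i, Measurable (X i)) (hY : ∀ i, Measurable (Y i))
    (hindep : iIndepFun (fun i w => (X i w, Y i w)) μ)
    (hlaw : ∀ i, μ.map (fun w => (X i w, Y i w)) = G ⊗ₘ κ)
    -- the linear quantile regression model with true value `θstar`
    (θstar : EuclideanSpace ℝ (Fin (p + 1)))
    (hmodel : ∀ᵐ x ∂G, QuantReg.quantile (κ x) τ = inner ℝ x θstar)
    -- `E(XXᵀ)` exists and is positive definite
    (hG : ∀ i j, Integrable (fun x : EuclideanSpace ℝ (Fin (p + 1)) => x i * x j) G)
    (hpos : (QuantReg.secondMoment G).PosDef)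
    -- finite conditional moment, and continuous conditional densities, bounded away from zero
    -- at the conditional quantile
    (hmoment : ∀ᵐ x ∂G, Integrable (fun y : ℝ => y) (κ x))
    (f : EuclideanSpace ℝ (Fin (p + 1)) → ℝ → ℝ)
    (hf : ∀ᵐ x ∂G, Continuous (f x) ∧ (∀ y, 0 ≤ f x y) ∧
      κ x = volume.withDensity fun y => ENNReal.ofReal (f x y))
    (hfpos : ∃ c : ℝ, 0 < c ∧ ∀ᵐ x ∂G, c ≤ f x (inner ℝ x θstar))
    -- the prior
    (Pri : Measure (EuclideanSpace ℝ (Fin (p + 1)))) [IsProbabilityMeasure Pri]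
    (hPri : QuantReg.HasContinuousPositiveDensityNear Pri θstar)
    -- the scale and the diverging sequence
    (ω : ℝ) (hω : 0 < ω) (a : ℕ → ℝ) (ha : Tendsto a atTop atTop) :
    TendstoInMeasure μ
      (fun n w => (QuantReg.gibbsPosterior τ ω Pri n (fun i => X i w) (fun i => Y i w)).real
        {θ | a n * (n : ℝ) ^ (-(1 / 2) : ℝ) < ‖θ - θstar‖})
      atTop (fun _ => (0 : ℝ)) := by
  obtain ⟨c₀, hc₀, hfq⟩ := hfpos
  obtain ⟨δ, c, C, hδ, hc, hC, hlow, hup⟩ := hPri.exists_closedBall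
  rw [tendstoInMeasure_iff_norm]
  intro η hη
  rw [ENNReal.tendsto_atTop_zero]
  intro ε' hε'
  obtain ⟨ε, -, hε, hεε'⟩ := ENNReal.lt_iff_exists_real_btwn.1 hε'
  replace hε : 0 < ε := ENNReal.ofReal_pos.1 hε
  -- These constants depend on `ε` but not on `n`, so `a n ≥ 2 K` eventually; no rate for `a` is
  -- needed.
  obtain ⟨K, B, L, hK, hB, hL, hgrowth⟩ :=
    QuantReg.exists_eventually_measure_compl_growth_le hτ hX hY hindep hlaw hmodel hG
      hpos hf hc₀ hfq hε
  have hbound := QuantReg.tendsto_posterior_bound ha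
    (by positivity : 0 < ω * B / (2 * K)) (by positivity : 0 < ω * B * δ / K)
    (C / c * 2 ^ (p + 1)) (Real.exp (ω * L)
      / (c * volume.real (Metric.ball (0 : EuclideanSpace ℝ (Fin (p + 1))) 1))) (p + 1)
  have hKδ : ∀ᶠ n : ℕ in atTop, K / √(n : ℝ) ≤ δ :=
    (tendsto_nhds_of_tendsto_nhdsWithin (QuantReg.tendsto_div_sqrt_nhdsGT_zero hK)).eventually
      (ge_mem_nhds hδ)
  have hnδ : ∀ᶠ n : ℕ in atTop, (n : ℝ)⁻¹ ≤ δ :=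
    (tendsto_inv_atTop_zero.comp tendsto_natCast_atTop_atTop).eventually (ge_mem_nhds hδ)
  refine eventually_atTop.1 ?_
  filter_upwards [hgrowth, hbound.eventually (gt_mem_nhds hη), hKδ, hnδ,
    ha.eventually_ge_atTop (2 * K), eventually_gt_atTop 0] with n hgood hlt hKδ hnδ han hn
  -- On the growth event the deterministic bound is already below `η`, so posterior mass of at least
  -- `η` can occur only on its complement.
  refine ((measure_mono fun w hw => ?_).trans hgood).trans hεε'.le
  rintro ⟨hsphere, hx⟩
  have h := QuantReg.gibbsPosterior_real_le hτ hω hn hK hB hL hc hC hlow hup hsphere hx han hKδ hnδ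
  have hw' : η ≤ ‖(QuantReg.gibbsPosterior τ ω Pri n (fun i => X i w) (fun i => Y i w)).real
      {θ | a n * (n : ℝ) ^ (-(1 / 2) : ℝ) < ‖θ - θstar‖} - 0‖ := hw
  rw [sub_zero, Real.norm_of_nonneg measureReal_nonneg] at hw'
  linarith
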